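/- **Proposition (indifference price with permanent impact).** *Model.* Let $Q,\sigma,\delta t,\gamma>0$, $S_0\in\mathbb R$, let $\mathcal N\subset\{1,\dots,N-1\}$ be non-empty, and let $V_1,\dots,V_N>0$ be deterministic. Let $L:\mathbb R\to\mathbb R_+$ be continuous, even, strictly convex, increasing on $\mathbb R_+$, with $L(0)=0$ and $L(\rho)/\rho\to+\infty$ as $\rho\to+\infty$. Let $\ell:\mathbb R\to\mathbb R$ be convex, even, non-decreasing on $\mathbb R_+$, with $\ell(0)=0$. Let $f\in L^1_{loc}(\mathbb R_+)$ be nonnegative and non-increasing on $(0,\infty)$ (possibly unbounded near $0$), and set $$G(q)=\int_q^Q f(|Q-y|)\,dy,\qquad F(q)=\int_q^Q y\,f(|Q-y|)\,dy .$$ Let $(\Omega,(\mathcal F_n),\mathbb P)$ be a filtered probability space. Let $(\epsilon_n,\epsilon'_n)_{1\le n\le N}$ be i.i.d. pairs with $(\epsilon_n,\epsilon'_n)$ $\mathcal F_n$-measurable and independent of $\mathcal F_{n-1}$, with mean $0$, variances $1$, covariance $\sqrt3/2$, and $\mathbb E[e^{t\epsilon_1}]+\mathbb E[e^{t\epsilon_1'}]<\infty$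 for all $t\ge 0$. An admissible strategy $(v,n^\star)\in\mathcal A$ consists of an adapted real process $v$ and a stopping time $n^\star$ with values in $\mathcal N\cup\{N\}$. It generates $q_0=Q$, $X_0=0$ and, with initial price $S_0$, $$q_{n+1}=q_n-v_n\delta t,\qquad S_{n+1}=S_n+\sigma\sqrt{\delta t}\,\epsilon_{n+1}+G(q_{n+1})-G(q_n),\qquad A_n=\frac1n\sum_{k=1}^n S_k\ (n\ge1),$$ $$X_{n+1}=X_n+v_nS_{n+1}\delta t-q_n\big(G(q_{n+1})-G(q_n)\big)+F(q_{n+1})-F(q_n)-\frac{\sigma v_n\delta t^{3/2}}{\sqrt3}\epsilon'_{n+1}+L\Big(\frac{v_n}{V_{n+1}}\Big)V_{n+1}\delta t .$$ The value at time $0$ is $$u_0=\sup_{(v,n^\star)\in\mathcal A}\mathbb E\Big[-\exp\Big(-\gamma\big(QA_{n^\star}-X_{n^\star}-q_{n^\star}S_{n^\star}-F(0)+F(q_{n^\star})-\ell(q_{n^\star})\big)\Big)\Big]\in[-\infty,0],$$ and the indifference price is the real number $\Pi$ defined by $u_0=-\exp(-\gamma(-\Pi))$. For $1\le n\le N$ and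 $q,Z\in\mathbb R$ define $\theta_n(q,Z)$ by backward recursion: $\theta_N(q,Z)=\ell(q)+F(0)$ and, for $n<N$, $\theta_n=\min\{\tilde\theta_{n},\ell+F(0)\}$ if $n\in\mathcal N$, and $\theta_n=\tilde\theta_{n}$ otherwise, where $$\tilde\theta_{n}(q,Z)=\inf_{v\in\mathbb R}\frac1\gamma\log\mathbb E\Big[\exp\Big(\gamma\Big(\sigma\sqrt{\delta t}\big((q-\tfrac{Q}{n+1})\epsilon_{n+1}-\tfrac{Q}{n+1}Z\big)-\tfrac{\sigma v\delta t^{3/2}}{\sqrt3}\epsilon'_{n+1}-\tfrac{Q}{n+1}\Delta+L\big(\tfrac{v}{V_{n+1}}\big)V_{n+1}\delta t+\theta_{n+1}\big(q-v\delta t,\tfrac{n}{n+1}(Z+\epsilon_{n+1}+\tfrac{\Delta}{\sigma\sqrt{\delta t}})\big)\Big)\Big)\Big],$$ with $\Delta=G(q-v\delta t)-G(q)$. Expectations of nonnegative variables, their logarithms, and $\theta_n$ may take the value $+\infty$. *Claim.* The indifference price $\Pi\in\mathbb R$ exists and is unique, and $$\Pi=\inf_{v\in\mathbb R}\frac1\gamma\log\mathbb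 E\Big[\exp\Big(\gamma\Big(-\frac{\sigma v\delta t^{3/2}}{\sqrt3}\epsilon'_1-Q\big(G(Q-v\delta t)-G(Q)\big)+L\Big(\frac v{V_1}\Big)V_1\delta t+\theta_1(Q-v\delta t,0)\Big)\Big)\Big]$$ $$=\inf_{v\in\mathbb R}\Big\{\frac1\gamma h\Big(-\gamma\frac{v\delta t}{\sqrt3}\Big)-Q\big(G(Q-v\delta t)-G(Q)\big)+L\Big(\frac v{V_1}\Big)V_1\delta t+\theta_1(Q-v\delta t,0)\Big\},$$ where $h(t)=\log\mathbb E[\exp(t\,\sigma\sqrt{\delta t}\,\epsilon_1')]\in(-\infty,+\infty]$ is the cumulant-generating function of $\sigma\sqrt{\delta t}\,\epsilon'_1$. -/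

import Mathlib

open MeasureTheory ProbabilityTheory Filter
open scoped ENNReal

noncomputable section

namespace ASR

/-- The data of an accelerated share repurchase contract and of its market model, with permanent
impact, over a probability space `Ω`. Days are indexed by `0, …, N`. -/
structure Model (Ω : Type*) where
  /-- number of days of the contract -/
  N : ℕ
  /-- days, before the last one, at which the bank may deliver -/
  exercise : Set ℕ
  /-- number of shares to be repurchased -/
  Q : ℝ
  /-- initial price of the share -/
  S₀ : ℝ
  /-- arithmetic volatility -/
  σ : ℝ
  /-- length of a day -/
  δt : ℝ
  /-- absolute risk aversion -/
  γ : ℝ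
  /-- `V (n + 1)` is the market volume (per unit of time) over the period `[t_n, t_{n+1}]` -/
  V : ℕ → ℝ
  /-- execution cost function -/
  L : ℝ → ℝ
  /-- penalty function at delivery -/
  ℓ : ℝ → ℝ
  /-- permanent impact function (only its values on the positive half-line matter) -/
  f : ℝ → ℝ
  /-- price noise -/
  ε : ℕ → Ω → ℝ
  /-- noise in the execution price -/
  ε' : ℕ → Ω → ℝ

namespace Model

variable {Ω : Type*}

/-- The standing assumptions on the deterministic data of the model. -/
structure IsRegular (M : Model Ω) : Prop where
  exercise_nonempty : M.exercise.Nonempty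
  exercise_subset : ∀ n ∈ M.exercise, 1 ≤ n ∧ n < M.N
  Q_pos : 0 < M.Q
  σ_pos : 0 < M.σ
  δt_pos : 0 < M.δt
  γ_pos : 0 < M.γ
  V_pos : ∀ n, 1 ≤ n → n ≤ M.N → 0 < M.V n
  L_continuous : Continuous M.L
  L_nonneg : ∀ x, 0 ≤ M.L x
  L_zero : M.L 0 = 0
  L_even : ∀ x, M.L (-x) = M.L x
  L_mono : MonotoneOn M.L (Set.Ici 0)
  L_strictConvex : StrictConvexOn ℝ Set.univ M.L
  L_superlinear : Tendsto (fun x => M.L x / x) atTop atTop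
  ℓ_convex : ConvexOn ℝ Set.univ M.ℓ
  ℓ_even : ∀ x, M.ℓ (-x) = M.ℓ x
  ℓ_mono : MonotoneOn M.ℓ (Set.Ici 0)
  ℓ_zero : M.ℓ 0 = 0
  /- The impact function may be unbounded near the origin. -/
  f_nonneg : ∀ x, 0 < x → 0 ≤ M.f x
  f_anti : AntitoneOn M.f (Set.Ioi 0)
  f_locInt : LocallyIntegrableOn M.f (Set.Ici 0)

/-- The standing assumptions on the noise: the pairs `(ε n, ε' n)`, `1 ≤ n ≤ N`, are adapted to the
filtration, independent of the past and identically distributed (hence i.i.d.), centred, with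
covariance matrix `((1, √3/2), (√3/2, 1))`, and exponential moments of nonnegative order. -/
structure IsNoise [MeasurableSpace Ω] (M : Model Ω) (ℱ : Filtration ℕ ‹MeasurableSpace Ω›)
    (P : Measure Ω) : Prop where
  measurable_fst : ∀ n, 1 ≤ n → n ≤ M.N → Measurable[ℱ n] (M.ε n)
  measurable_snd : ∀ n, 1 ≤ n → n ≤ M.N → Measurable[ℱ n] (M.ε' n)
  indep : ∀ n, n < M.N → Indep (ℱ n)
    (MeasurableSpace.comap (fun ω => (M.ε (n + 1) ω, M.ε' (n + 1) ω)) inferInstance) P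
  identDistrib : ∀ n, 1 ≤ n → n ≤ M.N →
    IdentDistrib (fun ω => (M.ε n ω, M.ε' n ω)) (fun ω => (M.ε 1 ω, M.ε' 1 ω)) P P
  memLp_fst : MemLp (M.ε 1) 2 P
  memLp_snd : MemLp (M.ε' 1) 2 P
  mean_fst : ∫ ω, M.ε 1 ω ∂P = 0
  mean_snd : ∫ ω, M.ε' 1 ω ∂P = 0
  var_fst : variance (M.ε 1) P = 1
  var_snd : variance (M.ε' 1) P = 1
  cov : covariance (M.ε 1) (M.ε' 1) P = √3 / 2
  mgf_fst : ∀ t : ℝ, 0 ≤ t → Integrable (fun ω => Real.exp (t * M.ε 1 ω)) P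
  mgf_snd : ∀ t : ℝ, 0 ≤ t → Integrable (fun ω => Real.exp (t * M.ε' 1 ω)) P

variable (M : Model Ω)

/-- `G(q) = ∫_q^Q f(|Q - y|) dy`. -/
def G (q : ℝ) : ℝ := ∫ y in q..M.Q, M.f |M.Q - y|

/-- `F(q) = ∫_q^Q y f(|Q - y|) dy`. -/
def F (q : ℝ) : ℝ := ∫ y in q..M.Q, y * M.f |M.Q - y|

/-- Number of shares remaining to be bought at time `n`, starting from `q` at time `0`, when
`v k * δt` shares are bought over the period `[t_k, t_{k+1}]`. -/
def shares (q : ℝ) (v : ℕ → Ω → ℝ) (n : ℕ) (ω : Ω) : ℝ :=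
  q - ∑ k ∈ Finset.range n, v k ω * M.δt

/-- The price at time `n`, starting from `S` at time `0`. -/
def price (q S : ℝ) (v : ℕ → Ω → ℝ) : ℕ → Ω → ℝ
  | 0, _ => S
  | n + 1, ω => price q S v n ω + M.σ * √M.δt * M.ε (n + 1) ω
      + (M.G (M.shares q v (n + 1) ω) - M.G (M.shares q v n ω))

/-- The average of the prices `S_1, …, S_n`, for `n ≥ 1`. -/
def average (q S : ℝ) (v : ℕ → Ω → ℝ) (n : ℕ) (ω : Ω) : ℝ :=
  (1 / (n : ℝ)) * ∑ k ∈ Finset.range n, M.price q S v (k + 1) ω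

/-- The cash spent up to time `n`, starting from `x` at time `0`. -/
def cash (x q S : ℝ) (v : ℕ → Ω → ℝ) : ℕ → Ω → ℝ
  | 0, _ => x
  | n + 1, ω => cash x q S v n ω
      + v n ω * M.price q S v (n + 1) ω * M.δt
      - M.shares q v n ω * (M.G (M.shares q v (n + 1) ω) - M.G (M.shares q v n ω))
      + (M.F (M.shares q v (n + 1) ω) - M.F (M.shares q v n ω))
      - M.σ * v n ω * M.δt ^ (3 / 2 : ℝ) / √3 * M.ε' (n + 1) ω
      + M.L (v n ω / M.V (n + 1)) * M.V (n + 1) * M.δt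

/-- Terminal wealth of the bank when it delivers at time `n`. -/
def wealth (x q S : ℝ) (v : ℕ → Ω → ℝ) (n : ℕ) (ω : Ω) : ℝ :=
  M.Q * M.average q S v n ω - M.cash x q S v n ω - M.shares q v n ω * M.price q S v n ω
    - M.F 0 + M.F (M.shares q v n ω) - M.ℓ (M.shares q v n ω)

variable [MeasurableSpace Ω] (ℱ : Filtration ℕ ‹MeasurableSpace Ω›) (P : Measure Ω)

/-- Admissible strategies: an adapted trading rate and a delivery time, which is a stopping time
with values in `exercise ∪ {N}`. Values of `v` from the delivery time on play no role. -/
structure Admissible (v : ℕ → Ω → ℝ) (τ : Ω → ℕ) : Prop where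
  adapted : Adapted ℱ v
  stopping : IsStoppingTime ℱ (fun ω => (τ ω : WithTop ℕ))
  mem : ∀ ω, τ ω ∈ M.exercise ∪ {M.N}

/-- The expected utility `𝔼[-exp(-γ W)] ∈ [-∞, 0]` of the terminal wealth of a strategy. -/
def expectedUtility (x q S : ℝ) (v : ℕ → Ω → ℝ) (τ : Ω → ℕ) : EReal :=
  -((∫⁻ ω, ENNReal.ofReal (Real.exp (-M.γ * M.wealth x q S v (τ ω) ω)) ∂P : ℝ≥0∞) : EReal)

/-- The value function at time `0`: supremum of the expected utility over all admissible
strategies. -/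
def valueZero (x q S : ℝ) : EReal :=
  ⨆ (v : ℕ → Ω → ℝ) (τ : Ω → ℕ) (_ : M.Admissible ℱ v τ), M.expectedUtility P x q S v τ

/-- `p` is the indifference price of the contract: `u₀(0, Q, S₀) = -exp(-γ (-p))`. -/
def IsIndifferencePrice (p : ℝ) : Prop :=
  M.valueZero ℱ P 0 M.Q M.S₀ = ((-Real.exp (-M.γ * -p) : ℝ) : EReal)

/-- The entropic functional `(1/γ) log 𝔼[exp(γ Y)]` of a random variable with values in
`[-∞, ∞]`. -/
def entropic (Y : Ω → EReal) : EReal :=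
  ((1 / M.γ : ℝ) : EReal) * ENNReal.log (∫⁻ ω, EReal.exp ((M.γ : EReal) * Y ω) ∂P)

/-- The functions `θ_n(q, Z)`, defined by backward recursion on `n ≤ N`, starting from
`θ_N(q, Z) = ℓ(q) + F(0)`. -/
def theta (n : ℕ) (q Z : ℝ) : EReal :=
  open Classical in
  if _h : n < M.N then
    let cont : EReal := ⨅ v : ℝ, M.entropic P fun ω =>
      ((M.σ * √M.δt * ((q - M.Q / (n + 1)) * M.ε (n + 1) ω - M.Q / (n + 1) * Z)
          - M.σ * v * M.δt ^ (3 / 2 : ℝ) / √3 * M.ε' (n + 1) ω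
          - M.Q / (n + 1) * (M.G (q - v * M.δt) - M.G q)
          + M.L (v / M.V (n + 1)) * M.V (n + 1) * M.δt : ℝ) : EReal)
        + theta (n + 1) (q - v * M.δt)
            ((n : ℝ) / (n + 1) * (Z + M.ε (n + 1) ω
              + (M.G (q - v * M.δt) - M.G q) / (M.σ * √M.δt)))
    if n ∈ M.exercise then min cont ((M.ℓ q + M.F 0 : ℝ) : EReal) else cont
  else ((M.ℓ q + M.F 0 : ℝ) : EReal)
termination_by M.N - n

end Model

/-- The cumulant-generating function `t ↦ log 𝔼[exp(t X)]` of a real random variable, with value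
`+∞` where the exponential moment is infinite. -/
def cumulantGF {Ω : Type*} [MeasurableSpace Ω] (X : Ω → ℝ) (P : Measure Ω) (t : ℝ) : EReal :=
  ENNReal.log (∫⁻ ω, ENNReal.ofReal (Real.exp (t * X ω)) ∂P)

end ASR

end

noncomputable section

namespace ASR

/-! ### Parametric minimisation of lower semicontinuous coercive functions -/

/-! With `Z_n = (S_n - A_n) / (σ √δt)`, minus the wealth at delivery is a sum of one-period costs in
`(q_k, Z_k, v_k, ε_{k+1}, ε'_{k+1})` plus `ℓ(q_n) + F(0)` (`neg_wealth_eq`). The initial price drops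
out, leaving a Markov problem of control and stopping in the state `(q, Z)`. It is solved for `exp
(γ θ_n)` with values in `[0, ∞]`, where the recursion has no logarithm and infinite values are
harmless.

Verification: the disutility of a strategy, continued optimally after time `n`, has nondecreasing
expectation in `n`, and constant expectation for an optimal feedback. Hence `u₀ = -exp (γ θ_0(Q,
0))` (`valueZero_eq`).

The feedback exists because the infima over `v` are attained measurably. Jensen's inequality, the
centring of the noise and the superlinearity of `L` bound the cost of rate `v` below by `exp (|v| -
K (1 + |q| + |Z|))` (`exists_le_contCost`). Fatou's lemma gives lower semicontinuity, which suffices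
to select the smallest minimiser.

The same lower bounds give `θ_0(Q, 0) > -∞`; never trading gives `θ_0(Q, 0) < ∞` (`expTheta_Q_le`).
Both formulas are the recursion at `n = 0`, where `ε_1` disappears. -/

theorem _root_.LowerSemicontinuous.comp_of_continuous {X Y β : Type*} [TopologicalSpace X]
    [TopologicalSpace Y] [Preorder β] {f : Y → β} {g : X → Y} (hf : LowerSemicontinuous f)
    (hg : Continuous g) : LowerSemicontinuous fun x => f (g x) :=
  fun x y hy => hg.continuousAt.eventually (hf (g x) y hy)

/-- `φ x v → ∞` as `|v| → ∞`, locally uniformly in the parameter `x`. -/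
def LocallyCoercive {X : Type*} [TopologicalSpace X] (φ : X → ℝ → ℝ≥0∞) : Prop :=
  ∀ x₀, ∀ c < ∞, ∃ R : ℝ, ∀ᶠ x in nhds x₀, ∀ v, R < |v| → c < φ x v

section ParametricMin

variable {X : Type*} [TopologicalSpace X] {φ : X → ℝ → ℝ≥0∞}

theorem lowerSemicontinuous_section (hφ : LowerSemicontinuous (Function.uncurry φ)) (x : X) :
    LowerSemicontinuous (φ x) :=
  hφ.comp_of_continuous (by fun_prop : Continuous fun v : ℝ => (x, v))

/-- Near `x₀` coercivity confines the infimum to a compact set of `v`, on which strict lower bounds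
persist by a tube argument. A general closed `D` serves the half-lines used in the measurable
selection. -/
theorem lowerSemicontinuous_biInf (hφ : LowerSemicontinuous (Function.uncurry φ))
    (hc : LocallyCoercive φ) {D : Set ℝ} (hD : IsClosed D) :
    LowerSemicontinuous fun x => ⨅ v ∈ D, φ x v := by
  intro x₀ y hy
  obtain ⟨c, hyc, hc'⟩ := exists_between hy
  obtain ⟨R, hR⟩ := hc x₀ c (hc'.trans_le le_top)
  have hK : IsCompact (D ∩ Set.Icc (-R) R) := isCompact_Icc.inter_left hD
  have h := hK.eventually_forall_of_forall_eventually (x₀ := x₀) (P := fun x v => c < φ x v)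
    (fun v hv => hφ (x₀, v) c (hc'.trans_le (iInf₂_le v hv.1)))
  filter_upwards [hR, h] with x h1 h2
  refine hyc.trans_le (le_iInf₂ fun v hv => ?_)
  by_cases hvR : R < |v|
  · exact (h1 v hvR).le
  · exact (h2 v ⟨hv, abs_le.1 (not_lt.1 hvR)⟩).le

theorem exists_eq_biInf (hφ : LowerSemicontinuous (Function.uncurry φ))
    (hc : LocallyCoercive φ) {D : Set ℝ} (hD : IsClosed D) {x : X}
    (hx : ⨅ v ∈ D, φ x v < ∞) : ∃ v ∈ D, φ x v = ⨅ v ∈ D, φ x v := by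
  obtain ⟨c, hyc, hc'⟩ := exists_between hx
  obtain ⟨R, hR⟩ := hc x c hc'
  have hR := hR.self_of_nhds
  have hlt : ∀ v, φ x v < c → v ∈ Set.Icc (-R) R := fun v hv =>
    abs_le.1 (not_lt.1 fun h => (hR v h).not_gt hv)
  obtain ⟨w, hw⟩ := iInf_lt_iff.1 hyc
  obtain ⟨hwD, hw⟩ := iInf_lt_iff.1 hw
  have hK : IsCompact (D ∩ Set.Icc (-R) R) := isCompact_Icc.inter_left hD
  obtain ⟨a, ha, hmin⟩ := LowerSemicontinuousOn.exists_isMinOn (f := φ x) (s := D ∩ Set.Icc (-R) R)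
    ⟨w, hwD, hlt w hw⟩ hK
    ((lowerSemicontinuous_section hφ x).lowerSemicontinuousOn _)
  refine ⟨a, ha.1, le_antisymm (le_iInf₂ fun v hv => ?_) (iInf₂_le a ha.1)⟩
  by_cases hvc : φ x v < c
  · exact hmin ⟨hv, hlt v hvc⟩
  · exact ((hmin ⟨hwD, hlt w hw⟩).trans hw.le).trans (not_lt.1 hvc)

/-- A lower semicontinuous and locally coercive function of `(x, v)` has a minimiser in `v` which
is a measurable function of `x`, namely the smallest one. -/
theorem exists_measurable_minimizer [MeasurableSpace X] [OpensMeasurableSpace X]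
    (hφ : LowerSemicontinuous (Function.uncurry φ)) (hc : LocallyCoercive φ) :
    ∃ s : X → ℝ, Measurable s ∧ ∀ x, φ x (s x) = ⨅ v, φ x v := by
  classical
  set m : X → ℝ≥0∞ := fun x => ⨅ v, φ x v with hm
  have hmD : ∀ x, m x = ⨅ v ∈ (Set.univ : Set ℝ), φ x v := by simp [hm]
  have hmeas : ∀ D : Set ℝ, IsClosed D → Measurable fun x => ⨅ v ∈ D, φ x v := fun D hD =>
    (lowerSemicontinuous_biInf hφ hc hD).measurable
  have hm_meas : Measurable m := by
    have := hmeas _ isClosed_univ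
    simpa [hm] using this
  let A : X → Set ℝ := fun x => {v | φ x v ≤ m x}
  have hA_closed : ∀ x, IsClosed (A x) := fun x =>
    (lowerSemicontinuous_section hφ x).isClosed_preimage (m x)
  have hA_ne : ∀ x, m x < ∞ → (A x).Nonempty := fun x hx => by
    obtain ⟨v, -, hv⟩ := exists_eq_biInf hφ hc isClosed_univ (by rw [← hmD]; exact hx)
    exact ⟨v, by rw [← hmD] at hv; exact hv.le⟩
  have hA_bdd : ∀ x, m x < ∞ → BddBelow (A x) := fun x hx => by
    obtain ⟨R, hR⟩ := hc x (m x) hx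
    exact ⟨-R, fun v hv => (abs_le.1 (not_lt.1 fun h =>
      (hR.self_of_nhds v h).not_ge hv)).1⟩
  have hmem : ∀ x, m x < ∞ → sInf (A x) ∈ A x := fun x hx =>
    (hA_closed x).csInf_mem (hA_ne x hx) (hA_bdd x hx)
  -- Where the infimum is `∞` every `v` is a minimiser, so the default `0` is legitimate.
  refine ⟨fun x => if m x < ∞ then sInf (A x) else 0, ?_, fun x => ?_⟩
  · refine measurable_of_Iic fun c => ?_
    -- The smallest minimiser is at most `c` exactly when the infimum over `(-∞, c]` already equals
    -- the global one; both infima are measurable in `x`.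
    have hset : (fun x => if m x < ∞ then sInf (A x) else 0) ⁻¹' Set.Iic c =
        ({x | m x < ∞} ∩ {x | ⨅ v ∈ Set.Iic c, φ x v ≤ m x}) ∪
          ({x | m x < ∞}ᶜ ∩ {_x | 0 ≤ c}) := by
      ext x
      by_cases hx : m x < ∞
      · simp only [Set.mem_preimage, hx, if_true, Set.mem_Iic, Set.mem_union, Set.mem_inter_iff,
          Set.mem_ofPred_eq, true_and, Set.mem_compl_iff, not_true, false_and, or_false]
        constructor
        · intro h
          exact (iInf₂_le (sInf (A x)) h).trans (hmem x hx)
        · intro h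
          obtain ⟨v, hvc, hv⟩ := exists_eq_biInf hφ hc (isClosed_Iic (a := c)) (h.trans_lt hx)
          have hvA : v ∈ A x := by
            change φ x v ≤ m x
            rw [hv]; exact h
          exact (csInf_le (hA_bdd x hx) hvA).trans hvc
      · simp [hx]
    rw [hset]
    have h1 : MeasurableSet {x | m x < ∞} := measurableSet_lt hm_meas measurable_const
    exact (h1.inter (measurableSet_le (hmeas _ isClosed_Iic) hm_meas)).union
      (h1.compl.inter (MeasurableSet.const _))
  · by_cases hx : m x < ∞
    · simp only [hx, if_true]
      exact le_antisymm (hmem x hx) (iInf_le _ _)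
    · simp only [hx, if_false]
      have htop : m x = ∞ := not_lt_top_iff.1 hx
      change φ x 0 = m x
      exact le_antisymm (htop ▸ le_top) (iInf_le _ _)

end ParametricMin

/-! ### Integrals -/

/-- Jensen's inequality, without assuming a finite exponential moment. -/
theorem ofReal_exp_integral_le_lintegral {Ω : Type*} [MeasurableSpace Ω] {P : Measure Ω}
    [IsProbabilityMeasure P] {X : Ω → ℝ} (hX : Integrable X P) :
    ENNReal.ofReal (Real.exp (∫ ω, X ω ∂P)) ≤ ∫⁻ ω, ENNReal.ofReal (Real.exp (X ω)) ∂P := by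
  by_cases h : Integrable (fun ω => Real.exp (X ω)) P
  · rw [← ofReal_integral_eq_lintegral_ofReal h (ae_of_all _ fun ω => (Real.exp_pos _).le)]
    exact ENNReal.ofReal_le_ofReal (convexOn_exp.map_integral_le Real.continuous_exp.continuousOn
      isClosed_univ (by simp) hX h)
  · have hm : AEStronglyMeasurable (fun ω => Real.exp (X ω)) P :=
      Real.continuous_exp.comp_aestronglyMeasurable hX.1
    have : ∫⁻ ω, ENNReal.ofReal (Real.exp (X ω)) ∂P = ∞ := by
      by_contra hne
      exact h ((lintegral_ofReal_ne_top_iff_integrable hm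
        (ae_of_all _ fun ω => (Real.exp_pos _).le)).1 hne)
    rw [this]
    exact le_top

/-- Freezing lemma: the joint law is a product, so Tonelli applies. It plays the role of
conditioning on the past. -/
theorem lintegral_comp_of_indep {Ω β β' : Type*} {m mΩ : MeasurableSpace Ω} [mβ : MeasurableSpace β]
    [mβ' : MeasurableSpace β'] {P : Measure Ω} [IsProbabilityMeasure P] (hm : m ≤ mΩ)
    {U : Ω → β} {ξ : Ω → β'} (hU : Measurable[m] U) (hξ : Measurable ξ)
    (hind : Indep m (MeasurableSpace.comap ξ mβ') P) {g : β × β' → ℝ≥0∞} (hg : Measurable g) :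
    ∫⁻ ω, g (U ω, ξ ω) ∂P = ∫⁻ ω, ∫⁻ ω', g (U ω, ξ ω') ∂P ∂P := by
  have hU' : Measurable U := hU.mono hm le_rfl
  have hi : IndepFun U ξ P := indep_of_indep_of_le_left hind hU.comap_le
  have hmap := (indepFun_iff_map_prod_eq_prod_map_map hU'.aemeasurable hξ.aemeasurable).1 hi
  have : IsProbabilityMeasure (P.map ξ) := Measure.isProbabilityMeasure_map hξ.aemeasurable
  calc ∫⁻ ω, g (U ω, ξ ω) ∂P = ∫⁻ z, g z ∂(P.map fun ω => (U ω, ξ ω)) :=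
        (lintegral_map hg (hU'.prodMk hξ)).symm
    _ = ∫⁻ x, ∫⁻ y, g (x, y) ∂(P.map ξ) ∂(P.map U) := by
        rw [hmap, lintegral_prod _ hg.aemeasurable]
    _ = ∫⁻ ω, ∫⁻ y, g (U ω, y) ∂(P.map ξ) ∂P :=
        lintegral_map hg.lintegral_prod_right' hU'
    _ = _ := by
        refine lintegral_congr fun ω => ?_
        exact lintegral_map (hg.comp measurable_prodMk_left) hξ

/-- Fatou's lemma along the neighbourhood filter, which first countability makes countably
generated. -/
theorem lowerSemicontinuous_lintegral {X Ω : Type*} [TopologicalSpace X]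
    [FirstCountableTopology X] [MeasurableSpace Ω] {P : Measure Ω} {F : X → Ω → ℝ≥0∞}
    (hm : ∀ x, Measurable (F x)) (hF : ∀ ω, LowerSemicontinuous fun x => F x ω) :
    LowerSemicontinuous fun x => ∫⁻ ω, F x ω ∂P := by
  refine lowerSemicontinuous_iff_le_liminf.2 fun x => ?_
  exact (lintegral_mono fun ω => lowerSemicontinuous_iff_le_liminf.1 (hF ω) x).trans
    (lintegral_liminf_le hm)

theorem _root_.LowerSemicontinuous.ennreal_mul {X : Type*} [TopologicalSpace X] {f g : X → ℝ≥0∞}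
    (hf : LowerSemicontinuous f) (hg : LowerSemicontinuous g) :
    LowerSemicontinuous fun x => f x * g x := by
  refine lowerSemicontinuous_iff_le_liminf.2 fun x => ?_
  exact (mul_le_mul' (lowerSemicontinuous_iff_le_liminf.1 hf x)
    (lowerSemicontinuous_iff_le_liminf.1 hg x)).trans ENNReal.le_liminf_mul

/-! ### The order isomorphism `x ↦ exp (γ x)` -/

/-- The order isomorphism `x ↦ exp (γ x)` from `[-∞, ∞]` to `[0, ∞]`. -/
def expMul (γ : ℝ) (x : EReal) : ℝ≥0∞ := EReal.exp ((γ : EReal) * x)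

theorem inv_mul_cancel_ereal {γ : ℝ} (hγ : 0 < γ) (x : EReal) :
    (γ : EReal) * (((1 / γ : ℝ) : EReal) * x) = x := by
  rw [← mul_assoc, ← EReal.coe_mul, mul_one_div_cancel hγ.ne', EReal.coe_one, one_mul]

theorem mul_inv_cancel_ereal {γ : ℝ} (hγ : 0 < γ) (x : EReal) :
    ((1 / γ : ℝ) : EReal) * ((γ : EReal) * x) = x := by
  rw [← mul_assoc, ← EReal.coe_mul, one_div_mul_cancel hγ.ne', EReal.coe_one, one_mul]

theorem expMul_strictMono {γ : ℝ} (hγ : 0 < γ) : StrictMono (expMul γ) := by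
  have hmono : ∀ {c : ℝ}, 0 < c → Monotone fun x : EReal => (c : EReal) * x := fun hc x y h =>
    mul_le_mul_of_nonneg_left h (EReal.coe_nonneg.2 hc.le)
  have h : StrictMono fun x : EReal => (γ : EReal) * x := by
    refine (hmono hγ).strictMono_of_injective fun x y h => ?_
    have := congrArg (fun z : EReal => ((1 / γ : ℝ) : EReal) * z) h
    simpa only [mul_inv_cancel_ereal hγ] using this
  exact EReal.exp_strictMono.comp h

/-- `expMul` as an order isomorphism. -/
def expMulIso {γ : ℝ} (hγ : 0 < γ) : EReal ≃o ℝ≥0∞ :=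
  (expMul_strictMono hγ).orderIsoOfRightInverse (expMul γ)
    (fun y => ((1 / γ : ℝ) : EReal) * ENNReal.log y)
    fun y => by rw [expMul, inv_mul_cancel_ereal hγ, ENNReal.exp_log]

theorem expMul_log {γ : ℝ} (hγ : 0 < γ) (y : ℝ≥0∞) :
    expMul γ (((1 / γ : ℝ) : EReal) * ENNReal.log y) = y := by
  rw [expMul, inv_mul_cancel_ereal hγ, ENNReal.exp_log]

theorem expMul_coe (γ x : ℝ) : expMul γ (x : EReal) = ENNReal.ofReal (Real.exp (γ * x)) := by
  rw [expMul, ← EReal.coe_mul, EReal.exp_coe]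

theorem expMul_iInf {γ : ℝ} (hγ : 0 < γ) {ι : Sort*} (g : ι → EReal) :
    expMul γ (⨅ i, g i) = ⨅ i, expMul γ (g i) :=
  (expMulIso hγ).map_iInf g

/-- No side condition is needed: the convention `⊥ + ⊤ = ⊥` matches `0 * ∞ = 0`. -/
theorem expMul_add {γ : ℝ} (hγ : 0 < γ) (x y : EReal) :
    expMul γ (x + y) = expMul γ x * expMul γ y := by
  have h : (γ : EReal) * (x + y) = γ * x + γ * y :=
    EReal.left_distrib_of_nonneg_of_ne_top (EReal.coe_nonneg.2 hγ.le) (EReal.coe_ne_top _) x y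
  rw [expMul, h, EReal.exp_add, expMul, expMul]

namespace Model

variable {Ω : Type*} {M : Model Ω}

/-! ### The impact and cost functions -/

theorem intervalIntegrable_f_abs (hM : M.IsRegular) (a b : ℝ) :
    IntervalIntegrable (fun x => M.f |x|) volume a b := by
  have h0 : ∀ b : ℝ, 0 ≤ b → IntervalIntegrable (fun x => M.f |x|) volume 0 b := by
    intro b hb
    have h := hM.f_locInt.integrableOn_compact_subset
      (Set.Icc_subset_Ici_self : Set.Icc 0 b ⊆ Set.Ici 0) isCompact_Icc
    refine ((intervalIntegrable_iff_integrableOn_Icc_of_le hb).2 h).congr fun x hx => ?_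
    rw [Set.uIoc_of_le hb] at hx
    simp [abs_of_pos hx.1]
  have h1 : ∀ b : ℝ, IntervalIntegrable (fun x => M.f |x|) volume 0 b := by
    intro b
    rcases le_total 0 b with hb | hb
    · exact h0 b hb
    · rw [IntervalIntegrable.iff_comp_neg]
      simpa using h0 (-b) (by linarith)
  exact (h1 a).symm.trans (h1 b)

theorem G_eq_integral (q : ℝ) : M.G q = ∫ x in (0 : ℝ)..(M.Q - q), M.f |x| := by
  have h := intervalIntegral.integral_comp_sub_left (a := q) (b := M.Q) (fun x => M.f |x|) M.Q
  rw [sub_self] at h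
  exact h

theorem continuous_G (hM : M.IsRegular) : Continuous M.G := by
  have h := intervalIntegral.continuous_primitive (intervalIntegrable_f_abs hM) 0
  have h2 : M.G = fun q => ∫ x in (0 : ℝ)..(M.Q - q), M.f |x| := funext G_eq_integral
  rw [h2]
  exact h.comp (continuous_const.sub continuous_id)

/-- The possible singularity at the origin contributes a finite integral over `[0, 1]`; beyond `1`,
monotonicity gives `f ≤ f 1`. Linear growth lets the superlinear cost `L` dominate the impact. -/
theorem exists_abs_G_le (hM : M.IsRegular) : ∃ A, 0 ≤ A ∧ ∀ q, |M.G q| ≤ A * (1 + |q|) := by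
  set C := ∫ x in (0 : ℝ)..1, |(M.f |x|)|
  have hf1 : 0 ≤ M.f 1 := hM.f_nonneg 1 one_pos
  have hC : 0 ≤ C := intervalIntegral.integral_nonneg zero_le_one fun _ _ => abs_nonneg _
  have hint := intervalIntegrable_f_abs hM
  have hpos : ∀ r : ℝ, 0 ≤ r → |∫ x in (0 : ℝ)..r, (M.f |x|)| ≤ C + M.f 1 * r := by
    intro r hr
    rcases le_total r 1 with h1 | h1
    · have h2 : |∫ x in (0 : ℝ)..r, (M.f |x|)| ≤ ∫ x in (0 : ℝ)..r, |(M.f |x|)| :=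
        intervalIntegral.abs_integral_le_integral_abs hr
      have h3 : ∫ x in (0 : ℝ)..r, |(M.f |x|)| ≤ C :=
        intervalIntegral.integral_mono_interval le_rfl hr h1
          (ae_of_all _ fun _ => abs_nonneg _) (hint 0 1).abs
      nlinarith
    · have h2 : |∫ x in (0 : ℝ)..1, (M.f |x|)| ≤ C :=
        intervalIntegral.abs_integral_le_integral_abs zero_le_one
      have h3 : ‖∫ x in (1 : ℝ)..r, M.f |x|‖ ≤ M.f 1 * |r - 1| := by
        refine intervalIntegral.norm_integral_le_of_norm_le_const fun x hx => ?_
        rw [Set.uIoc_of_le h1] at hx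
        have hx0 : 0 < x := one_pos.trans hx.1
        rw [abs_of_pos hx0, Real.norm_of_nonneg (hM.f_nonneg x hx0)]
        exact hM.f_anti (Set.mem_Ioi.2 one_pos) (Set.mem_Ioi.2 hx0) hx.1.le
      rw [Real.norm_eq_abs, abs_of_nonneg (sub_nonneg.2 h1)] at h3
      rw [← intervalIntegral.integral_add_adjacent_intervals (hint 0 1) (hint 1 r)]
      refine (abs_add_le _ _).trans ?_
      nlinarith
  have hall : ∀ r : ℝ, |∫ x in (0 : ℝ)..r, (M.f |x|)| ≤ C + M.f 1 * |r| := by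
    intro r
    rcases le_total 0 r with hr | hr
    · simpa [abs_of_nonneg hr] using hpos r hr
    · have h := hpos (-r) (by linarith)
      have h2 := intervalIntegral.integral_comp_neg (a := 0) (b := r) (fun x => M.f |x|)
      simp only [abs_neg, neg_zero] at h2
      rw [h2, intervalIntegral.integral_symm, abs_neg, abs_of_nonpos hr]
      exact h
  refine ⟨C + M.f 1 * (1 + |M.Q|), by positivity, fun q => ?_⟩
  rw [G_eq_integral]
  refine (hall _).trans ?_
  have h := abs_sub M.Q q
  nlinarith [abs_nonneg q, abs_nonneg M.Q, mul_nonneg hf1 (abs_nonneg M.Q),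
    mul_nonneg hC (abs_nonneg q), mul_nonneg (mul_nonneg hf1 (abs_nonneg M.Q)) (abs_nonneg q),
    mul_le_mul_of_nonneg_left h hf1]

theorem exists_linear_le_L (hM : M.IsRegular) {K : ℝ} (hK : 0 ≤ K) :
    ∃ B, 0 ≤ B ∧ ∀ x, K * |x| - B ≤ M.L x := by
  obtain ⟨R, hR⟩ := eventually_atTop.1 (hM.L_superlinear.eventually_ge_atTop K)
  have hR1 : 0 < max R 1 := lt_max_of_lt_right one_pos
  refine ⟨K * max R 1, by positivity, fun x => ?_⟩
  have habs : M.L x = M.L |x| := by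
    rcases abs_choice x with h | h <;> rw [h]
    rw [hM.L_even]
  rcases le_total (max R 1) |x| with h | h
  · have h2 := hR |x| ((le_max_left _ _).trans h)
    rw [le_div_iff₀ (hR1.trans_le h)] at h2
    rw [habs]
    nlinarith
  · nlinarith [hM.L_nonneg x]

theorem continuous_ℓ (hM : M.IsRegular) : Continuous M.ℓ :=
  continuousOn_univ.1 (hM.ℓ_convex.continuousOn isOpen_univ)

theorem ℓ_nonneg (hM : M.IsRegular) (x : ℝ) : 0 ≤ M.ℓ x := by
  have h : ∀ y, 0 ≤ y → 0 ≤ M.ℓ y := fun y hy => by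
    have := hM.ℓ_mono (Set.mem_Ici.2 le_rfl) (Set.mem_Ici.2 hy) hy
    rwa [hM.ℓ_zero] at this
  rcases le_total 0 x with hx | hx
  · exact h x hx
  · rw [← hM.ℓ_even]
    exact h _ (by linarith)

theorem two_le_N (hM : M.IsRegular) : 2 ≤ M.N := by
  obtain ⟨n, hn⟩ := hM.exercise_nonempty
  have := hM.exercise_subset n hn
  omega

/-! ### The noise -/

section Noise

variable [MeasurableSpace Ω] {ℱ : Filtration ℕ ‹MeasurableSpace Ω›} {P : Measure Ω} {n : ℕ}

theorem measurable_ε (hε : M.IsNoise ℱ P) (hn : n < M.N) : Measurable (M.ε (n + 1)) :=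
  (hε.measurable_fst (n + 1) (by omega) hn).mono (ℱ.le _) le_rfl

theorem measurable_ε' (hε : M.IsNoise ℱ P) (hn : n < M.N) : Measurable (M.ε' (n + 1)) :=
  (hε.measurable_snd (n + 1) (by omega) hn).mono (ℱ.le _) le_rfl

theorem identDistrib_ε (hε : M.IsNoise ℱ P) (hn : n < M.N) :
    IdentDistrib (M.ε (n + 1)) (M.ε 1) P P :=
  (hε.identDistrib (n + 1) (by omega) hn).comp measurable_fst

theorem identDistrib_ε' (hε : M.IsNoise ℱ P) (hn : n < M.N) :
    IdentDistrib (M.ε' (n + 1)) (M.ε' 1) P P :=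
  (hε.identDistrib (n + 1) (by omega) hn).comp measurable_snd

theorem integrable_ε [IsProbabilityMeasure P] (hε : M.IsNoise ℱ P) (hn : n < M.N) :
    Integrable (M.ε (n + 1)) P :=
  (identDistrib_ε hε hn).integrable_iff.2 (hε.memLp_fst.integrable one_le_two)

theorem integrable_ε' [IsProbabilityMeasure P] (hε : M.IsNoise ℱ P) (hn : n < M.N) :
    Integrable (M.ε' (n + 1)) P :=
  (identDistrib_ε' hε hn).integrable_iff.2 (hε.memLp_snd.integrable one_le_two)

theorem integral_ε (hε : M.IsNoise ℱ P) (hn : n < M.N) : ∫ ω, M.ε (n + 1) ω ∂P = 0 :=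
  (identDistrib_ε hε hn).integral_eq.trans hε.mean_fst

theorem integral_ε' (hε : M.IsNoise ℱ P) (hn : n < M.N) : ∫ ω, M.ε' (n + 1) ω ∂P = 0 :=
  (identDistrib_ε' hε hn).integral_eq.trans hε.mean_snd

theorem lintegral_exp_ε_lt_top (hε : M.IsNoise ℱ P) (hn : n < M.N) {t : ℝ} (ht : 0 ≤ t) :
    ∫⁻ ω, ENNReal.ofReal (Real.exp (t * M.ε (n + 1) ω)) ∂P < ∞ := by
  have hid : IdentDistrib (fun ω => Real.exp (t * M.ε (n + 1) ω))
      (fun ω => Real.exp (t * M.ε 1 ω)) P P :=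
    (identDistrib_ε hε hn).comp (by fun_prop : Measurable fun x : ℝ => Real.exp (t * x))
  exact (hid.integrable_iff.2 (hε.mgf_fst t ht)).lintegral_lt_top

end Noise

/-! ### One period of the control problem -/

variable (M)

/-- The increment of the cost over a period, when `v * δt` shares are bought, in terms of the noise
`(e, e')`. -/
def stepCost (n : ℕ) (q Z v e e' : ℝ) : ℝ :=
  M.σ * √M.δt * ((q - M.Q / (n + 1)) * e - M.Q / (n + 1) * Z)
    - M.σ * v * M.δt ^ (3 / 2 : ℝ) / √3 * e'
    - M.Q / (n + 1) * (M.G (q - v * M.δt) - M.G q)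
    + M.L (v / M.V (n + 1)) * M.V (n + 1) * M.δt

/-- The value at the end of a period of the normalised spread between price and average price. -/
def nextZ (n : ℕ) (q Z v e : ℝ) : ℝ :=
  (n : ℝ) / (n + 1) * (Z + e + (M.G (q - v * M.δt) - M.G q) / (M.σ * √M.δt))

/-- `exp (γ (ℓ q + F 0))`, the disutility of delivery. -/
def deliveryCost (q : ℝ) : ℝ≥0∞ := ENNReal.ofReal (Real.exp (M.γ * (M.ℓ q + M.F 0)))

variable {M}

theorem continuous_stepCost (hM : M.IsRegular) (n : ℕ) :
    Continuous fun p : ℝ × ℝ × ℝ × ℝ × ℝ =>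
      M.stepCost n p.1 p.2.1 p.2.2.1 p.2.2.2.1 p.2.2.2.2 := by
  have hG := continuous_G hM
  have hL := hM.L_continuous
  unfold stepCost
  fun_prop

theorem continuous_nextZ (hM : M.IsRegular) (n : ℕ) :
    Continuous fun p : ℝ × ℝ × ℝ × ℝ => M.nextZ n p.1 p.2.1 p.2.2.1 p.2.2.2 := by
  have hG := continuous_G hM
  unfold nextZ
  fun_prop

theorem continuous_deliveryCost (hM : M.IsRegular) : Continuous M.deliveryCost := by
  have := continuous_ℓ hM
  exact ENNReal.continuous_ofReal.comp
    (by fun_prop : Continuous fun q => Real.exp (M.γ * (M.ℓ q + M.F 0)))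

/-- Impact terms and the next state grow at most linearly in `v`, so `L` absorbs them and still
leaves `|v|`. The noise terms with unbounded coefficients are kept linear, so that centring removes
them later. -/
theorem exists_le_stepCost (hM : M.IsRegular) {n : ℕ} (hn : n < M.N) {a : ℝ} (ha : 0 ≤ a) :
    ∃ K, 0 ≤ K ∧ ∀ q Z v e e', M.γ * (M.σ * √M.δt * (q - M.Q / (n + 1))) * e
      - M.γ * (M.σ * v * M.δt ^ (3 / 2 : ℝ) / √3) * e' - a * |e| + |v| - K * (1 + |q| + |Z|) ≤
      M.γ * M.stepCost n q Z v e e' - a * (1 + |q - v * M.δt| + |M.nextZ n q Z v e|) := by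
  have hγ := hM.γ_pos
  have hδ := hM.δt_pos
  have hV : 0 < M.V (n + 1) := hM.V_pos (n + 1) (by omega) hn
  have hn1 : (0 : ℝ) < n + 1 := by positivity
  obtain ⟨A, hA, hG⟩ := exists_abs_G_le hM
  set s := M.σ * √M.δt with hs
  have hspos : 0 < s := mul_pos hM.σ_pos (Real.sqrt_pos.2 hδ)
  set c := M.Q / (n + 1) with hc
  have hcpos : 0 < c := div_pos hM.Q_pos hn1
  -- Total coefficient of `|Δ|`: `γ c` from the cost and `a / s` from the next spread.
  set w := M.γ * c + a / s with hw
  have hwpos : 0 ≤ w := by positivity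
  -- After multiplication by `γ δt`, this slope pays for `|v|`, for the part `w A δt |v|` of the
  -- impact bound, and for `a δt |v|` coming from the next inventory.
  obtain ⟨B, hB, hL⟩ := exists_linear_le_L hM
    (K := (1 + w * A * M.δt + a * M.δt) / (M.γ * M.δt)) (by positivity)
  refine ⟨M.γ * M.δt * M.V (n + 1) * B + M.γ * s * c + 2 * w * A + 2 * a, by positivity,
    fun q Z v e e' => ?_⟩
  set Δ := M.G (q - v * M.δt) - M.G q with hΔ
  have hq : |q - v * M.δt| ≤ |q| + |v| * M.δt := by
    refine (abs_sub _ _).trans ?_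
    rw [abs_mul, abs_of_pos hδ]
  have hΔb : |Δ| ≤ A * (2 + 2 * |q| + |v| * M.δt) := by
    refine (abs_sub _ _).trans ?_
    have h1 := hG (q - v * M.δt)
    have h2 := hG q
    nlinarith [mul_le_mul_of_nonneg_left hq hA]
  have hZ : |M.nextZ n q Z v e| ≤ |Z| + |e| + |Δ| / s := by
    have h1 : |(n : ℝ) / (n + 1)| ≤ 1 := by
      rw [abs_of_nonneg (by positivity), div_le_one hn1]
      linarith
    have h2 : |Z + e + Δ / s| ≤ |Z| + |e| + |Δ| / s := by
      have h3 := abs_add_le (Z + e) (Δ / s)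
      have h4 := abs_add_le Z e
      rw [abs_div, abs_of_pos hspos] at h3
      linarith
    rw [nextZ, abs_mul]
    exact (mul_le_of_le_one_left (abs_nonneg _) h1).trans h2
  have hLv : (1 + w * A * M.δt + a * M.δt) * |v| - M.γ * M.δt * M.V (n + 1) * B ≤
      M.γ * (M.L (v / M.V (n + 1)) * M.V (n + 1) * M.δt) := by
    have h1 := mul_le_mul_of_nonneg_left (hL (v / M.V (n + 1)))
      (by positivity : 0 ≤ M.γ * M.V (n + 1) * M.δt)
    rw [abs_div, abs_of_pos hV] at h1
    have h2 : M.γ * M.V (n + 1) * M.δt * ((1 + w * A * M.δt + a * M.δt) / (M.γ * M.δt) *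
        (|v| / M.V (n + 1)) - B) =
        (1 + w * A * M.δt + a * M.δt) * |v| - M.γ * M.δt * M.V (n + 1) * B := by
      field_simp
    linarith
  have h1 : M.γ * c * Δ ≤ M.γ * c * |Δ| := mul_le_mul_of_nonneg_left (le_abs_self _) (by positivity)
  have h2 : M.γ * s * c * Z ≤ M.γ * s * c * |Z| :=
    mul_le_mul_of_nonneg_left (le_abs_self _) (by positivity)
  have h3 : w * |Δ| ≤ w * (A * (2 + 2 * |q| + |v| * M.δt)) :=
    mul_le_mul_of_nonneg_left hΔb hwpos
  have h4 : a * |q - v * M.δt| ≤ a * (|q| + |v| * M.δt) := mul_le_mul_of_nonneg_left hq ha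
  have h5 : a * |M.nextZ n q Z v e| ≤ a * |Z| + a * |e| + a / s * |Δ| := by
    refine (mul_le_mul_of_nonneg_left hZ ha).trans_eq ?_
    ring
  have h6 : M.γ * M.stepCost n q Z v e e' = M.γ * (s * (q - c)) * e - M.γ * s * c * Z
      - M.γ * (M.σ * v * M.δt ^ (3 / 2 : ℝ) / √3) * e' - M.γ * c * Δ
      + M.γ * (M.L (v / M.V (n + 1)) * M.V (n + 1) * M.δt) := by
    rw [stepCost]
    ring
  have h7 : w * |Δ| = M.γ * c * |Δ| + a / s * |Δ| := by rw [hw]; ring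
  have p1 : 0 ≤ M.γ * M.δt * M.V (n + 1) * B * (|q| + |Z|) := by positivity
  have p2 : 0 ≤ M.γ * s * c * (1 + |q|) := by positivity
  have p3 : 0 ≤ 2 * w * A * |Z| := by positivity
  have p4 : 0 ≤ a * (1 + |q| + |Z|) := by positivity
  rw [h6]
  linarith

variable (M)

variable [MeasurableSpace Ω] (P : Measure Ω)

/-- `exp (γ θ_n)`. -/
def expTheta (n : ℕ) (q Z : ℝ) : ℝ≥0∞ := expMul M.γ (M.theta P n q Z)

/-- The disutility after one period, as a function of the noise. -/
def stepDisutility (n : ℕ) (q Z v e e' : ℝ) : ℝ≥0∞ :=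
  ENNReal.ofReal (Real.exp (M.γ * M.stepCost n q Z v e e')) *
    M.expTheta P (n + 1) (q - v * M.δt) (M.nextZ n q Z v e)

/-- The expected disutility of holding the contract for one period with trading rate `v`, and
proceeding optimally. -/
def contCost (n : ℕ) (q Z v : ℝ) : ℝ≥0∞ :=
  ∫⁻ ω, M.stepDisutility P n q Z v (M.ε (n + 1) ω) (M.ε' (n + 1) ω) ∂P

variable {M P}

theorem expMul_entropic (hγ : 0 < M.γ) (Y : Ω → EReal) :
    expMul M.γ (M.entropic P Y) = ∫⁻ ω, expMul M.γ (Y ω) ∂P :=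
  expMul_log hγ _

theorem expTheta_N (q Z : ℝ) : M.expTheta P M.N q Z = M.deliveryCost q := by
  rw [expTheta, theta, dif_neg (lt_irrefl _), expMul_coe, deliveryCost]

open Classical in
-- The order isomorphism commutes with infima and minima, and turns entropic functionals into plain
-- integrals.
theorem expTheta_of_lt (hγ : 0 < M.γ) {n : ℕ} (hn : n < M.N) (q Z : ℝ) :
    M.expTheta P n q Z = if n ∈ M.exercise then min (⨅ v, M.contCost P n q Z v) (M.deliveryCost q)
      else ⨅ v, M.contCost P n q Z v := by
  rw [expTheta, theta, dif_pos hn]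
  have h : expMul M.γ (⨅ v : ℝ, M.entropic P fun ω =>
        ((M.σ * √M.δt * ((q - M.Q / (n + 1)) * M.ε (n + 1) ω - M.Q / (n + 1) * Z)
          - M.σ * v * M.δt ^ (3 / 2 : ℝ) / √3 * M.ε' (n + 1) ω
          - M.Q / (n + 1) * (M.G (q - v * M.δt) - M.G q)
          + M.L (v / M.V (n + 1)) * M.V (n + 1) * M.δt : ℝ) : EReal)
        + M.theta P (n + 1) (q - v * M.δt)
            ((n : ℝ) / (n + 1) * (Z + M.ε (n + 1) ω
              + (M.G (q - v * M.δt) - M.G q) / (M.σ * √M.δt)))) =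
      ⨅ v, M.contCost P n q Z v := by
    rw [expMul_iInf hγ]
    refine iInf_congr fun v => ?_
    rw [expMul_entropic hγ]
    refine lintegral_congr fun ω => ?_
    rw [expMul_add hγ, expMul_coe]
    rfl
  split_ifs with hex
  · rw [(expMul_strictMono hγ).monotone.map_min, h, expMul_coe, deliveryCost]
  · exact h

theorem expTheta_le_contCost (hγ : 0 < M.γ) {n : ℕ} (hn : n < M.N) (q Z v : ℝ) :
    M.expTheta P n q Z ≤ M.contCost P n q Z v := by
  classical
  rw [expTheta_of_lt hγ hn]
  split_ifs
  · exact (min_le_left _ _).trans (iInf_le _ v)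
  · exact iInf_le _ v

theorem expTheta_le_deliveryCost (hγ : 0 < M.γ) (hM : M.IsRegular) {n : ℕ}
    (hn : n ∈ M.exercise ∪ {M.N}) (q Z : ℝ) : M.expTheta P n q Z ≤ M.deliveryCost q := by
  classical
  rcases hn with hn | hn
  · rw [expTheta_of_lt hγ (hM.exercise_subset n hn).2, if_pos hn]
    exact min_le_right _ _
  · rw [Set.mem_singleton_iff.1 hn, expTheta_N]

theorem lowerSemicontinuous_stepDisutility (hM : M.IsRegular) {n : ℕ}
    (h : LowerSemicontinuous fun p : ℝ × ℝ => M.expTheta P (n + 1) p.1 p.2) :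
    LowerSemicontinuous fun p : ℝ × ℝ × ℝ × ℝ × ℝ =>
      M.stepDisutility P n p.1 p.2.1 p.2.2.1 p.2.2.2.1 p.2.2.2.2 := by
  have h1 := continuous_stepCost hM n
  have h2 : Continuous fun p : ℝ × ℝ × ℝ × ℝ × ℝ =>
      (p.1 - p.2.2.1 * M.δt, M.nextZ n p.1 p.2.1 p.2.2.1 p.2.2.2.1) := by
    refine (by fun_prop : Continuous fun p : ℝ × ℝ × ℝ × ℝ × ℝ => p.1 - p.2.2.1 * M.δt).prodMk ?_
    exact (continuous_nextZ hM n).comp (by fun_prop :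
      Continuous fun p : ℝ × ℝ × ℝ × ℝ × ℝ => (p.1, p.2.1, p.2.2.1, p.2.2.2.1))
  have h3 := ENNReal.continuous_ofReal.comp (Real.continuous_exp.comp (h1.const_mul M.γ))
  exact h3.lowerSemicontinuous.ennreal_mul (h.comp_of_continuous h2)

theorem measurable_stepDisutility (hM : M.IsRegular) {n : ℕ}
    (h : LowerSemicontinuous fun p : ℝ × ℝ => M.expTheta P (n + 1) p.1 p.2) :
    Measurable fun p : ℝ × ℝ × ℝ × ℝ × ℝ =>
      M.stepDisutility P n p.1 p.2.1 p.2.2.1 p.2.2.2.1 p.2.2.2.2 :=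
  (lowerSemicontinuous_stepDisutility hM h).measurable

theorem locallyCoercive_contCost {n : ℕ} {K : ℝ}
    (h : ∀ q Z v, ENNReal.ofReal (Real.exp (|v| - K * (1 + |q| + |Z|))) ≤ M.contCost P n q Z v) :
    LocallyCoercive fun (p : ℝ × ℝ) v => M.contCost P n p.1 p.2 v := by
  intro p₀ c hc
  set g : ℝ × ℝ → ℝ := fun p => K * (1 + |p.1| + |p.2|)
  have hg : Continuous g := by fun_prop
  -- Near `p₀` one has `g p < g p₀ + 1`, and `exp x ≥ x + 1` does the rest.
  refine ⟨c.toReal + (g p₀ + 1), ?_⟩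
  filter_upwards [hg.continuousAt.eventually (gt_mem_nhds (lt_add_one (g p₀)))] with p hp v hv
  refine lt_of_lt_of_le ?_ (h p.1 p.2 v)
  rw [ENNReal.lt_ofReal_iff_toReal_lt hc.ne]
  have h1 := Real.add_one_le_exp (|v| - g p)
  change c.toReal < Real.exp (|v| - g p)
  linarith

section

variable {ℱ : Filtration ℕ ‹MeasurableSpace Ω›}

theorem lowerSemicontinuous_contCost (hM : M.IsRegular) (hε : M.IsNoise ℱ P) {n : ℕ} (hn : n < M.N)
    (h : LowerSemicontinuous fun p : ℝ × ℝ => M.expTheta P (n + 1) p.1 p.2) :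
    LowerSemicontinuous (Function.uncurry fun (p : ℝ × ℝ) v => M.contCost P n p.1 p.2 v) := by
  have hs := lowerSemicontinuous_stepDisutility hM h
  refine lowerSemicontinuous_lintegral (F := fun (p : (ℝ × ℝ) × ℝ) ω =>
    M.stepDisutility P n p.1.1 p.1.2 p.2 (M.ε (n + 1) ω) (M.ε' (n + 1) ω)) (fun p => ?_) fun ω => ?_
  · have he := measurable_ε hε hn
    have he' := measurable_ε' hε hn
    have hg : Measurable fun ω => (p.1.1, p.1.2, p.2, M.ε (n + 1) ω, M.ε' (n + 1) ω) := by
      fun_prop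
    have h2 := (measurable_stepDisutility hM h).comp hg
    exact h2
  · have h2 := hs.comp_of_continuous (by fun_prop : Continuous fun p : (ℝ × ℝ) × ℝ =>
      (p.1.1, p.1.2, p.2, M.ε (n + 1) ω, M.ε' (n + 1) ω))
    exact h2

/-! ### Finiteness -/

/-- Test the recursion with `v = 0` from `q = Q`. The exponent stays linear in `Z` with slope
proportional to `-(1 - n / N)`, and the next noise enters with coefficient proportional to `n / N ≥
0`, so only exponential moments of nonnegative order are used. -/
theorem expTheta_Q_le (hM : M.IsRegular) (hε : M.IsNoise ℱ P) (k n : ℕ) (hkn : n + k = M.N) :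
    ∃ K < ∞, ∀ Z, M.expTheta P n M.Q Z ≤ K * ENNReal.ofReal
      (Real.exp (-(M.γ * (M.σ * √M.δt) * (M.Q * (1 - n / M.N)) * Z))) := by
  have hγ := hM.γ_pos
  have hN : (0 : ℝ) < M.N := by
    have := two_le_N hM
    exact_mod_cast (by omega : 0 < M.N)
  induction k generalizing n with
  | zero =>
    obtain rfl : n = M.N := by omega
    refine ⟨M.deliveryCost M.Q, ENNReal.ofReal_lt_top, fun Z => ?_⟩
    rw [expTheta_N, div_self hN.ne']
    simp
  | succ k ih =>
    have hn : n < M.N := by omega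
    obtain ⟨K, hK, hle⟩ := ih (n + 1) (by omega)
    have hnN : (n : ℝ) + 1 ≤ M.N := by exact_mod_cast hn
    have hn1 : (0 : ℝ) < n + 1 := by positivity
    set s := M.σ * √M.δt with hs
    have hspos : 0 < s := mul_pos hM.σ_pos (Real.sqrt_pos.2 hM.δt_pos)
    set t := M.γ * s * (M.Q * (n / M.N)) with ht
    have htpos : 0 ≤ t := by have := hM.Q_pos; positivity
    refine ⟨K * ∫⁻ ω, ENNReal.ofReal (Real.exp (t * M.ε (n + 1) ω)) ∂P,
      ENNReal.mul_lt_top hK (lintegral_exp_ε_lt_top hε hn htpos), fun Z => ?_⟩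
    refine (expTheta_le_contCost hγ hn M.Q Z 0).trans ?_
    have he := measurable_ε hε hn
    rw [contCost, ← lintegral_const_mul _ (by fun_prop), ← lintegral_mul_const _ (by fun_prop)]
    refine lintegral_mono fun ω => ?_
    have h1 : M.Q - 0 * M.δt = M.Q := by ring
    simp only [stepDisutility, h1]
    refine (mul_le_mul_right (hle _) _).trans_eq ?_
    rw [mul_left_comm, mul_assoc K, ← ENNReal.ofReal_mul (Real.exp_pos _).le,
      ← ENNReal.ofReal_mul (Real.exp_pos _).le, ← Real.exp_add, ← Real.exp_add]
    congr 3
    simp only [stepCost, nextZ, h1, zero_div, hM.L_zero, ← hs, ht]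
    push_cast
    field_simp
    ring

theorem expTheta_zero_lt_top (hM : M.IsRegular) (hε : M.IsNoise ℱ P) :
    M.expTheta P 0 M.Q 0 < ∞ := by
  obtain ⟨K, hK, h⟩ := expTheta_Q_le hM hε M.N 0 (by omega)
  exact (h 0).trans_lt (ENNReal.mul_lt_top hK ENNReal.ofReal_lt_top)

/-! ### Lower bounds, measurability and optimal rates -/

variable [IsProbabilityMeasure P]

/-- By Jensen it suffices to integrate the exponent. The terms linear in the centred noise vanish
whatever their size in `q` and `v`; only the loss `a 𝔼|ε|` remains, and it is absorbed in the
constant. -/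
theorem exists_le_contCost (hM : M.IsRegular) (hε : M.IsNoise ℱ P) {n : ℕ} (hn : n < M.N)
    {a : ℝ} (ha : 0 ≤ a) (h : ∀ q Z, ENNReal.ofReal (Real.exp (-(a * (1 + |q| + |Z|)))) ≤
      M.expTheta P (n + 1) q Z) :
    ∃ K, 0 ≤ K ∧ ∀ q Z v, ENNReal.ofReal (Real.exp (|v| - K * (1 + |q| + |Z|))) ≤
      M.contCost P n q Z v := by
  obtain ⟨K, hK, hle⟩ := exists_le_stepCost hM hn ha
  set m := ∫ ω, |M.ε (n + 1) ω| ∂P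
  have hm : 0 ≤ m := integral_nonneg fun _ => abs_nonneg _
  refine ⟨K + a * m, by positivity, fun q Z v => ?_⟩
  set α := M.γ * (M.σ * √M.δt * (q - M.Q / (n + 1)))
  set β := M.γ * (M.σ * v * M.δt ^ (3 / 2 : ℝ) / √3)
  have hi := integrable_ε hε hn
  have hi' := integrable_ε' hε hn
  have i1 : Integrable (fun ω => α * M.ε (n + 1) ω) P := hi.const_mul α
  have i2 : Integrable (fun ω => β * M.ε' (n + 1) ω) P := hi'.const_mul β
  have i3 : Integrable (fun ω => a * |M.ε (n + 1) ω|) P := hi.abs.const_mul a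
  have i12 : Integrable (fun ω => α * M.ε (n + 1) ω - β * M.ε' (n + 1) ω) P := i1.sub i2
  have i123 : Integrable
      (fun ω => α * M.ε (n + 1) ω - β * M.ε' (n + 1) ω - a * |M.ε (n + 1) ω|) P := i12.sub i3
  have hX : Integrable (fun ω => α * M.ε (n + 1) ω - β * M.ε' (n + 1) ω - a * |M.ε (n + 1) ω|
      + (|v| - K * (1 + |q| + |Z|))) P := i123.add (integrable_const _)
  have hint : ∫ ω, (α * M.ε (n + 1) ω - β * M.ε' (n + 1) ω - a * |M.ε (n + 1) ω|
      + (|v| - K * (1 + |q| + |Z|))) ∂P = |v| - K * (1 + |q| + |Z|) - a * m := by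
    rw [integral_add i123 (integrable_const _), integral_sub i12 i3, integral_sub i1 i2,
      integral_const_mul, integral_const_mul, integral_const_mul, integral_ε hε hn,
      integral_ε' hε hn, integral_const]
    simp only [probReal_univ, one_smul]
    ring
  have hJ := ofReal_exp_integral_le_lintegral hX
  rw [hint] at hJ
  refine (ENNReal.ofReal_le_ofReal (Real.exp_le_exp.2 ?_)).trans (hJ.trans ?_)
  · nlinarith [mul_nonneg (mul_nonneg ha hm) (add_nonneg (abs_nonneg q) (abs_nonneg Z))]
  · refine lintegral_mono fun ω => ?_
    have h2 := h (q - v * M.δt) (M.nextZ n q Z v (M.ε (n + 1) ω))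
    refine le_trans ?_ (mul_le_mul_right h2 _)
    rw [← ENNReal.ofReal_mul (Real.exp_pos _).le, ← Real.exp_add]
    refine ENNReal.ofReal_le_ofReal (Real.exp_le_exp.2 ?_)
    have h3 := hle q Z v (M.ε (n + 1) ω) (M.ε' (n + 1) ω)
    linarith

/-- One backward induction for both: the lower bound at `n + 1` gives the coercivity in `v` that
makes the infimum at `n` lower semicontinuous. -/
theorem expTheta_lowerBound_and_lowerSemicontinuous (hM : M.IsRegular) (hε : M.IsNoise ℱ P)
    (k n : ℕ) (hkn : n + k = M.N) :
    (∃ a, 0 ≤ a ∧ ∀ q Z, ENNReal.ofReal (Real.exp (-(a * (1 + |q| + |Z|)))) ≤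
      M.expTheta P n q Z) ∧ LowerSemicontinuous fun p : ℝ × ℝ => M.expTheta P n p.1 p.2 := by
  classical
  have hγ := hM.γ_pos
  have hd : ∀ a, M.γ * |M.F 0| ≤ a → ∀ q Z : ℝ,
      ENNReal.ofReal (Real.exp (-(a * (1 + |q| + |Z|)))) ≤ M.deliveryCost q := by
    intro a ha q Z
    refine ENNReal.ofReal_le_ofReal (Real.exp_le_exp.2 ?_)
    have h1 := mul_le_mul_of_nonneg_left (neg_abs_le (M.F 0)) hγ.le
    have h2 := mul_nonneg hγ.le (ℓ_nonneg hM q)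
    have h3 : 0 ≤ a := (by positivity : 0 ≤ M.γ * |M.F 0|).trans ha
    nlinarith [mul_nonneg h3 (add_nonneg (abs_nonneg q) (abs_nonneg Z))]
  have hdc : LowerSemicontinuous fun p : ℝ × ℝ => M.deliveryCost p.1 :=
    ((continuous_deliveryCost hM).comp continuous_fst).lowerSemicontinuous
  induction k generalizing n with
  | zero =>
    obtain rfl : n = M.N := by omega
    simp only [expTheta_N]
    exact ⟨⟨M.γ * |M.F 0|, by positivity, hd _ le_rfl⟩, hdc⟩
  | succ k ih =>
    have hn : n < M.N := by omega
    obtain ⟨⟨a, ha, hle⟩, hlsc⟩ := ih (n + 1) (by omega)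
    obtain ⟨K, hK, hKle⟩ := exists_le_contCost hM hε hn ha hle
    have hKinf : ∀ K', K ≤ K' → ∀ q Z : ℝ, ENNReal.ofReal (Real.exp (-(K' * (1 + |q| + |Z|)))) ≤
        ⨅ v, M.contCost P n q Z v := by
      intro K' hKK q Z
      refine le_iInf fun v => le_trans ?_ (hKle q Z v)
      refine ENNReal.ofReal_le_ofReal (Real.exp_le_exp.2 ?_)
      nlinarith [abs_nonneg v, mul_le_mul_of_nonneg_right hKK
        (by positivity : 0 ≤ 1 + |q| + |Z|)]
    have hinf : LowerSemicontinuous fun p : ℝ × ℝ => ⨅ v, M.contCost P n p.1 p.2 v := by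
      simpa using lowerSemicontinuous_biInf (lowerSemicontinuous_contCost hM hε hn hlsc)
        (locallyCoercive_contCost hKle) isClosed_univ
    simp only [expTheta_of_lt hγ hn]
    split_ifs
    · exact ⟨⟨max K (M.γ * |M.F 0|), le_max_of_le_left hK, fun q Z =>
        le_min (hKinf _ (le_max_left _ _) q Z) (hd _ (le_max_right _ _) q Z)⟩, hinf.inf hdc⟩
    · exact ⟨⟨K, hK, hKinf K le_rfl⟩, hinf⟩

theorem lowerSemicontinuous_expTheta (hM : M.IsRegular) (hε : M.IsNoise ℱ P) {n : ℕ}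
    (hn : n ≤ M.N) : LowerSemicontinuous fun p : ℝ × ℝ => M.expTheta P n p.1 p.2 :=
  (expTheta_lowerBound_and_lowerSemicontinuous hM hε (M.N - n) n (by omega)).2

theorem expTheta_pos (hM : M.IsRegular) (hε : M.IsNoise ℱ P) {n : ℕ} (hn : n ≤ M.N) (q Z : ℝ) :
    0 < M.expTheta P n q Z := by
  obtain ⟨a, -, h⟩ := (expTheta_lowerBound_and_lowerSemicontinuous hM hε (M.N - n) n (by omega)).1
  exact (ENNReal.ofReal_pos.2 (Real.exp_pos _)).trans_le (h q Z)

theorem exists_measurable_optimal_rate (hM : M.IsRegular) (hε : M.IsNoise ℱ P) {n : ℕ}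
    (hn : n < M.N) : ∃ s : ℝ × ℝ → ℝ, Measurable s ∧
      ∀ p, M.contCost P n p.1 p.2 (s p) = ⨅ v, M.contCost P n p.1 p.2 v := by
  obtain ⟨⟨a, ha, hle⟩, hlsc⟩ :=
    expTheta_lowerBound_and_lowerSemicontinuous hM hε (M.N - (n + 1)) (n + 1) (by omega)
  obtain ⟨K, hK, hKle⟩ := exists_le_contCost hM hε hn ha hle
  exact exists_measurable_minimizer (lowerSemicontinuous_contCost hM hε hn hlsc)
    (locallyCoercive_contCost hKle)

end

/-! ### Change of variables -/

section Processes

variable {Ω : Type*} (M : Model Ω)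

/-- The spread `(S_n - A_n) / (σ √δt)` between the price and the average price, starting from `Q`
shares. -/
def spread (v : ℕ → Ω → ℝ) : ℕ → Ω → ℝ
  | 0, _ => 0
  | n + 1, ω => M.nextZ n (M.shares M.Q v n ω) (spread v n ω) (v n ω) (M.ε (n + 1) ω)

/-- The cost accumulated before time `n`. -/
def totalCost (v : ℕ → Ω → ℝ) (n : ℕ) (ω : Ω) : ℝ :=
  ∑ k ∈ Finset.range n, M.stepCost k (M.shares M.Q v k ω) (M.spread v k ω) (v k ω)
    (M.ε (k + 1) ω) (M.ε' (k + 1) ω)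

/-- The disutility of a delivery at time `n`. -/
def deliveryDisutility (v : ℕ → Ω → ℝ) (n : ℕ) (ω : Ω) : ℝ≥0∞ :=
  ENNReal.ofReal (Real.exp (M.γ * M.totalCost v n ω)) * M.deliveryCost (M.shares M.Q v n ω)

variable {M}

theorem shares_succ (q : ℝ) (v : ℕ → Ω → ℝ) (n : ℕ) (ω : Ω) :
    M.shares q v (n + 1) ω = M.shares q v n ω - v n ω * M.δt := by
  rw [shares, shares, Finset.sum_range_succ]
  ring

theorem totalCost_succ (v : ℕ → Ω → ℝ) (n : ℕ) (ω : Ω) :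
    M.totalCost v (n + 1) ω = M.totalCost v n ω + M.stepCost n (M.shares M.Q v n ω)
      (M.spread v n ω) (v n ω) (M.ε (n + 1) ω) (M.ε' (n + 1) ω) := by
  rw [totalCost, Finset.sum_range_succ, totalCost]

/-- This is `n (S_n - A_n)`, free of division so that the induction can start at `n = 0`. It rests
on `(n + 1) A_{n+1} = n A_n + S_{n+1}`. -/
theorem spread_mul (hM : M.IsRegular) (S : ℝ) (v : ℕ → Ω → ℝ) (n : ℕ) (ω : Ω) :
    n * (M.σ * √M.δt * M.spread v n ω) =
      n * M.price M.Q S v n ω - ∑ k ∈ Finset.range n, M.price M.Q S v (k + 1) ω := by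
  have hs : M.σ * √M.δt ≠ 0 := (mul_pos hM.σ_pos (Real.sqrt_pos.2 hM.δt_pos)).ne'
  induction n with
  | zero => simp
  | succ n ih =>
    have hn : (n : ℝ) + 1 ≠ 0 := by positivity
    rw [Finset.sum_range_succ]
    have h1 : ((n + 1 : ℕ) : ℝ) * (M.σ * √M.δt * M.spread v (n + 1) ω) =
        n * (M.σ * √M.δt * M.spread v n ω) + n * (M.σ * √M.δt * M.ε (n + 1) ω +
          (M.G (M.shares M.Q v (n + 1) ω) - M.G (M.shares M.Q v n ω))) := by
      rw [spread, nextZ, shares_succ]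
      generalize M.σ * √M.δt = s at hs
      push_cast
      field_simp
      ring
    rw [h1, ih, price]
    push_cast
    ring

/-- In `X + q S - F(q)` the impact terms cancel by summation by parts, and the price contributes
only `q_n σ √δt ε_{n+1}`. Writing the average as `S - σ √δt Z` gives it the value `S_0` at time `0`,
so both sides start at `0`. -/
theorem cash_add_eq_totalCost (S : ℝ) (v : ℕ → Ω → ℝ) (n : ℕ) (ω : Ω)
    (hs : M.σ * √M.δt ≠ 0) :
    M.cash 0 M.Q S v n ω + M.shares M.Q v n ω * M.price M.Q S v n ω - M.F (M.shares M.Q v n ω)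
      - M.Q * (M.price M.Q S v n ω - M.σ * √M.δt * M.spread v n ω) = M.totalCost v n ω := by
  induction n with
  | zero => simp [cash, price, shares, spread, totalCost, F]
  | succ n ih =>
    have hn : (n : ℝ) + 1 ≠ 0 := by positivity
    rw [totalCost_succ, ← ih, cash, price, spread, shares_succ, nextZ, stepCost]
    generalize M.σ * √M.δt = s at hs
    field_simp
    ring

theorem neg_wealth_eq (hM : M.IsRegular) (S : ℝ) (v : ℕ → Ω → ℝ) {n : ℕ} (hn : 1 ≤ n) (ω : Ω) :
    -M.wealth 0 M.Q S v n ω =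
      M.totalCost v n ω + (M.ℓ (M.shares M.Q v n ω) + M.F 0) := by
  have hs : M.σ * √M.δt ≠ 0 := (mul_pos hM.σ_pos (Real.sqrt_pos.2 hM.δt_pos)).ne'
  have hn0 : (n : ℝ) ≠ 0 := by positivity
  have h : M.average M.Q S v n ω = M.price M.Q S v n ω - M.σ * √M.δt * M.spread v n ω := by
    have h1 := spread_mul hM S v n ω
    rw [average]
    field_simp
    linarith
  rw [← cash_add_eq_totalCost S v n ω hs, wealth, h]
  ring

theorem ofReal_exp_wealth (hM : M.IsRegular) (S : ℝ) (v : ℕ → Ω → ℝ) {n : ℕ} (hn : 1 ≤ n) (ω : Ω) :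
    ENNReal.ofReal (Real.exp (-M.γ * M.wealth 0 M.Q S v n ω)) = M.deliveryDisutility v n ω := by
  rw [deliveryDisutility, deliveryCost, ← ENNReal.ofReal_mul (Real.exp_pos _).le, ← Real.exp_add,
    ← mul_add, ← neg_wealth_eq hM S v hn]
  congr 2
  ring

variable (M) in
/-- The state `(q_n, Z_n)` under the feedback strategy `s`. -/
def feedbackState (s : ℕ → ℝ × ℝ → ℝ) : ℕ → Ω → ℝ × ℝ
  | 0, _ => (M.Q, 0)
  | n + 1, ω =>
    ((feedbackState s n ω).1 - s n (feedbackState s n ω) * M.δt,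
      M.nextZ n (feedbackState s n ω).1 (feedbackState s n ω).2 (s n (feedbackState s n ω))
        (M.ε (n + 1) ω))

/-- Rate and state determine each other; constructing the state first breaks the circle, and this
identity closes it. -/
theorem feedbackState_eq (s : ℕ → ℝ × ℝ → ℝ) (n : ℕ) (ω : Ω) :
    M.feedbackState s n ω = (M.shares M.Q (fun n ω => s n (M.feedbackState s n ω)) n ω,
      M.spread (fun n ω => s n (M.feedbackState s n ω)) n ω) := by
  induction n with
  | zero => simp [feedbackState, shares, spread]
  | succ n ih =>
    rw [shares_succ, spread, feedbackState, Prod.mk.injEq]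
    have h1 := congrArg Prod.fst ih
    have h2 := congrArg Prod.snd ih
    simp only at h1 h2
    rw [← h1, ← h2]
    exact ⟨rfl, rfl⟩

end Processes

/-! ### Dynamic programming -/

section DynamicProgramming

variable {Ω : Type*} [mΩ : MeasurableSpace Ω] {ℱ : Filtration ℕ mΩ} {P : Measure Ω} {M : Model Ω}
  {v : ℕ → Ω → ℝ} {τ : Ω → ℕ}

theorem measurable_shares (hv : Adapted ℱ v) (n : ℕ) : Measurable[ℱ n] (M.shares M.Q v n) := by
  refine Measurable.sub measurable_const ?_
  refine Finset.measurable_fun_sum _ fun k hk => ?_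
  exact ((hv k).mono (ℱ.mono (Finset.mem_range.1 hk).le) le_rfl).mul_const _

theorem measurable_spread (hM : M.IsRegular) (hε : M.IsNoise ℱ P) (hv : Adapted ℱ v) {n : ℕ}
    (hn : n ≤ M.N) : Measurable[ℱ n] (M.spread v n) := by
  induction n with
  | zero => exact measurable_const
  | succ n ih =>
    have hle : ℱ n ≤ ℱ (n + 1) := ℱ.mono n.le_succ
    have h1 := (measurable_shares (M := M) hv n).mono hle le_rfl
    have h2 := (ih (by omega)).mono hle le_rfl
    have h3 := (hv n).mono hle le_rfl
    have h4 := hε.measurable_fst (n + 1) (by omega) hn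
    exact (continuous_nextZ hM n).measurable.comp (h1.prodMk (h2.prodMk (h3.prodMk h4)))

theorem measurable_totalCost (hM : M.IsRegular) (hε : M.IsNoise ℱ P) (hv : Adapted ℱ v) {n : ℕ}
    (hn : n ≤ M.N) : Measurable[ℱ n] (M.totalCost v n) := by
  refine Finset.measurable_fun_sum _ fun k hk => ?_
  have hk := Finset.mem_range.1 hk
  have hle : ℱ k ≤ ℱ n := ℱ.mono hk.le
  have h1 := (measurable_shares (M := M) hv k).mono hle le_rfl
  have h2 := (measurable_spread hM hε hv (by omega : k ≤ M.N)).mono hle le_rfl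
  have h3 := (hv k).mono hle le_rfl
  have h4 := (hε.measurable_fst (k + 1) (by omega) (by omega)).mono (ℱ.mono hk) le_rfl
  have h5 := (hε.measurable_snd (k + 1) (by omega) (by omega)).mono (ℱ.mono hk) le_rfl
  have h6 := (continuous_stepCost hM k).measurable
  have h7 := h1.prodMk (h2.prodMk (h3.prodMk (h4.prodMk h5)))
  have h8 := h6.comp h7
  exact h8

variable (M P) in
/-- The optimal conditional disutility at time `n` along a strategy that has not delivered. -/
def runningDisutility (v : ℕ → Ω → ℝ) (n : ℕ) (ω : Ω) : ℝ≥0∞ :=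
  ENNReal.ofReal (Real.exp (M.γ * M.totalCost v n ω)) *
    M.expTheta P n (M.shares M.Q v n ω) (M.spread v n ω)

variable (M P) in
/-- The optimal conditional disutility at time `n` along a strategy. -/
def stoppedDisutility (v : ℕ → Ω → ℝ) (τ : Ω → ℕ) (n : ℕ) (ω : Ω) : ℝ≥0∞ :=
  if τ ω < n then M.deliveryDisutility v (τ ω) ω else M.runningDisutility P v n ω

theorem measurable_feedbackState (hM : M.IsRegular) (hε : M.IsNoise ℱ P) {s : ℕ → ℝ × ℝ → ℝ}
    (hs : ∀ n, Measurable (s n)) {n : ℕ} (hn : n ≤ M.N) :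
    Measurable[ℱ n] (M.feedbackState s n) := by
  induction n with
  | zero => exact measurable_const
  | succ n ih =>
    have h1 := (ih (by omega)).mono (ℱ.mono n.le_succ) le_rfl
    have h2 := (hs n).comp h1
    have h3 := hε.measurable_fst (n + 1) (by omega) hn
    refine ((measurable_fst.comp h1).sub (h2.mul_const M.δt)).prodMk ?_
    exact (continuous_nextZ hM n).measurable.comp ((measurable_fst.comp h1).prodMk
      ((measurable_snd.comp h1).prodMk (h2.prodMk h3)))

/-- At the horizon `exp (γ θ_N)` is the delivery cost, so the stopped disutility is the realised one
even when `τ = N`. -/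
theorem expectedUtility_eq (hM : M.IsRegular) (hadm : M.Admissible ℱ v τ) (S : ℝ) :
    M.expectedUtility P 0 M.Q S v τ =
      -((∫⁻ ω, M.stoppedDisutility P v τ M.N ω ∂P : ℝ≥0∞) : EReal) := by
  rw [expectedUtility]
  congr 2
  refine lintegral_congr fun ω => ?_
  have h2 := two_le_N hM
  have hτ : 1 ≤ τ ω ∧ τ ω ≤ M.N := by
    rcases hadm.mem ω with h | h
    · have := hM.exercise_subset _ h
      omega
    · have := Set.mem_singleton_iff.1 h
      omega
  rw [ofReal_exp_wealth hM S v hτ.1, stoppedDisutility]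
  split_ifs with h
  · rfl
  · have hN : τ ω = M.N := le_antisymm hτ.2 (not_lt.1 h)
    rw [hN, runningDisutility, expTheta_N, deliveryDisutility]

variable [IsProbabilityMeasure P]

theorem setLIntegral_runningDisutility_succ (hM : M.IsRegular) (hε : M.IsNoise ℱ P)
    (hv : Adapted ℱ v) {n : ℕ} (hn : n < M.N) {A : Set Ω} (hA : MeasurableSet[ℱ n] A) :
    ∫⁻ ω in A, M.runningDisutility P v (n + 1) ω ∂P =
      ∫⁻ ω in A, ENNReal.ofReal (Real.exp (M.γ * M.totalCost v n ω)) *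
        M.contCost P n (M.shares M.Q v n ω) (M.spread v n ω) (v n ω) ∂P := by
  have hA' : MeasurableSet A := ℱ.le n A hA
  have hsd := measurable_stepDisutility hM (lowerSemicontinuous_expTheta hM hε hn)
  -- The event is moved into a factor known at time `n`, and is frozen with the rest of the past.
  set c : Ω → ℝ≥0∞ := A.indicator fun ω => ENNReal.ofReal (Real.exp (M.γ * M.totalCost v n ω))
  have hc : Measurable[ℱ n] c :=
    (Real.measurable_exp.comp
      ((measurable_totalCost hM hε hv hn.le).const_mul M.γ)).ennreal_ofReal.indicator hA
  let U : Ω → ℝ≥0∞ × ℝ × ℝ × ℝ := fun ω =>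
    (c ω, M.shares M.Q v n ω, M.spread v n ω, v n ω)
  let ξ : Ω → ℝ × ℝ := fun ω => (M.ε (n + 1) ω, M.ε' (n + 1) ω)
  let g : (ℝ≥0∞ × ℝ × ℝ × ℝ) × (ℝ × ℝ) → ℝ≥0∞ := fun z => z.1.1 *
    M.stepDisutility P n z.1.2.1 z.1.2.2.1 z.1.2.2.2 z.2.1 z.2.2
  have hU : Measurable[ℱ n] U := hc.prodMk ((measurable_shares hv n).prodMk
    ((measurable_spread hM hε hv hn.le).prodMk (hv n)))
  have hξ : Measurable ξ := (measurable_ε hε hn).prodMk (measurable_ε' hε hn)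
  have hg2 : Measurable fun z : (ℝ≥0∞ × ℝ × ℝ × ℝ) × (ℝ × ℝ) =>
      (z.1.2.1, z.1.2.2.1, z.1.2.2.2, z.2.1, z.2.2) := by fun_prop
  have hg : Measurable g := by
    have h2 := hsd.comp hg2
    exact (by fun_prop : Measurable fun z : (ℝ≥0∞ × ℝ × ℝ × ℝ) × (ℝ × ℝ) => z.1.1).mul h2
  have hfreeze := lintegral_comp_of_indep (ℱ.le n) hU hξ (hε.indep n hn) hg
  rw [← lintegral_indicator hA', ← lintegral_indicator hA']
  refine Eq.trans (lintegral_congr fun ω => ?_) (hfreeze.trans (lintegral_congr fun ω => ?_))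
  · by_cases hω : ω ∈ A
    · rw [Set.indicator_of_mem hω]
      simp only [g, U, ξ, c, Set.indicator_of_mem hω]
      rw [runningDisutility, stepDisutility, totalCost_succ, shares_succ, spread, mul_add,
        Real.exp_add, ENNReal.ofReal_mul (Real.exp_pos _).le, mul_assoc]
    · simp only [g, U, c, Set.indicator_of_notMem hω, zero_mul]
  · have hm : Measurable fun ω' => M.stepDisutility P n (M.shares M.Q v n ω) (M.spread v n ω)
        (v n ω) (M.ε (n + 1) ω') (M.ε' (n + 1) ω') := by
      have h3 : Measurable fun ω' => (M.shares M.Q v n ω, M.spread v n ω, v n ω,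
          M.ε (n + 1) ω', M.ε' (n + 1) ω') :=
        measurable_const.prodMk (measurable_const.prodMk (measurable_const.prodMk hξ))
      have h4 := hsd.comp h3
      exact h4
    have h5 : ∫⁻ ω', g (U ω, ξ ω') ∂P =
        c ω * M.contCost P n (M.shares M.Q v n ω) (M.spread v n ω) (v n ω) :=
      lintegral_const_mul _ hm
    rw [h5]
    by_cases hω : ω ∈ A
    · simp only [c, Set.indicator_of_mem hω]
    · simp only [c, Set.indicator_of_notMem hω, zero_mul]

theorem measurableSet_lt_delivery (hadm : M.Admissible ℱ v τ) (n : ℕ) :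
    MeasurableSet[ℱ n] {ω | n < τ ω} := by
  simpa using hadm.stopping.measurableSet_gt n

theorem lintegral_stoppedDisutility_succ (hM : M.IsRegular) (hε : M.IsNoise ℱ P)
    (hadm : M.Admissible ℱ v τ) {n : ℕ} (hn : n < M.N) :
    ∫⁻ ω, M.stoppedDisutility P v τ (n + 1) ω ∂P =
      (∫⁻ ω in {ω | n < τ ω}, ENNReal.ofReal (Real.exp (M.γ * M.totalCost v n ω)) *
        M.contCost P n (M.shares M.Q v n ω) (M.spread v n ω) (v n ω) ∂P) +
      ∫⁻ ω in {ω | n < τ ω}ᶜ, M.deliveryDisutility v (τ ω) ω ∂P := by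
  have hA := measurableSet_lt_delivery hadm n
  have hA' : MeasurableSet {ω | n < τ ω} := ℱ.le n _ hA
  rw [← lintegral_add_compl _ hA', ← setLIntegral_runningDisutility_succ hM hε hadm.adapted hn hA]
  congr 1
  · refine setLIntegral_congr_fun hA' fun ω hω => ?_
    exact if_neg (by simpa using Nat.succ_le_of_lt hω)
  · refine setLIntegral_congr_fun hA'.compl fun ω hω => ?_
    exact if_pos (Nat.lt_succ_of_le (not_lt.1 hω))

/-- Submartingale inequality: before delivery `exp (γ θ_n)` is at most the cost of any rate; on `τ =
n` it is at most the delivery cost; on `τ < n` nothing changes. -/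
theorem lintegral_stoppedDisutility_le_succ (hM : M.IsRegular) (hε : M.IsNoise ℱ P)
    (hadm : M.Admissible ℱ v τ) {n : ℕ} (hn : n < M.N) :
    ∫⁻ ω, M.stoppedDisutility P v τ n ω ∂P ≤ ∫⁻ ω, M.stoppedDisutility P v τ (n + 1) ω ∂P := by
  have hA' : MeasurableSet {ω | n < τ ω} := ℱ.le n _ (measurableSet_lt_delivery hadm n)
  rw [lintegral_stoppedDisutility_succ hM hε hadm hn, ← lintegral_add_compl _ hA']
  refine add_le_add (setLIntegral_mono' hA' fun ω hω => ?_)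
    (setLIntegral_mono' hA'.compl fun ω hω => ?_)
  · rw [stoppedDisutility, if_neg (not_lt.2 (le_of_lt hω)), runningDisutility]
    exact mul_le_mul_right (expTheta_le_contCost hM.γ_pos hn _ _ _) _
  · rw [stoppedDisutility]
    split_ifs with h
    · exact le_rfl
    · have hτ : τ ω = n := le_antisymm (not_lt.1 hω) (not_lt.1 h)
      rw [hτ, runningDisutility, deliveryDisutility]
      exact mul_le_mul_right (expTheta_le_deliveryCost hM.γ_pos hM (hτ ▸ hadm.mem ω) _ _) _

theorem lintegral_stoppedDisutility_eq_succ (hM : M.IsRegular) (hε : M.IsNoise ℱ P)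
    (hadm : M.Admissible ℱ v τ)
    (hhold : ∀ n ω, n < τ ω → M.expTheta P n (M.shares M.Q v n ω) (M.spread v n ω) =
      M.contCost P n (M.shares M.Q v n ω) (M.spread v n ω) (v n ω))
    (hdeliver : ∀ ω, M.expTheta P (τ ω) (M.shares M.Q v (τ ω) ω) (M.spread v (τ ω) ω) =
      M.deliveryCost (M.shares M.Q v (τ ω) ω)) {n : ℕ} (hn : n < M.N) :
    ∫⁻ ω, M.stoppedDisutility P v τ n ω ∂P = ∫⁻ ω, M.stoppedDisutility P v τ (n + 1) ω ∂P := by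
  have hA' : MeasurableSet {ω | n < τ ω} := ℱ.le n _ (measurableSet_lt_delivery hadm n)
  rw [lintegral_stoppedDisutility_succ hM hε hadm hn, ← lintegral_add_compl _ hA']
  refine congrArg₂ _ (setLIntegral_congr_fun hA' fun ω hω => ?_)
    (setLIntegral_congr_fun hA'.compl fun ω hω => ?_)
  · simp only [stoppedDisutility]
    rw [if_neg (not_lt.2 (le_of_lt hω)), runningDisutility, hhold n ω hω]
  · simp only [stoppedDisutility]
    split_ifs with h
    · rfl
    · have hτ : τ ω = n := le_antisymm (not_lt.1 hω) (not_lt.1 h)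
      have h2 := hdeliver ω
      rw [hτ] at h2 ⊢
      rw [runningDisutility, deliveryDisutility, h2]

theorem lintegral_stoppedDisutility_zero (v : ℕ → Ω → ℝ) (τ : Ω → ℕ) :
    ∫⁻ ω, M.stoppedDisutility P v τ 0 ω ∂P = M.expTheta P 0 M.Q 0 := by
  simp [stoppedDisutility, runningDisutility, totalCost, shares, spread]

theorem expectedUtility_le (hM : M.IsRegular) (hε : M.IsNoise ℱ P) (hadm : M.Admissible ℱ v τ)
    (S : ℝ) : M.expectedUtility P 0 M.Q S v τ ≤ -((M.expTheta P 0 M.Q 0 : ℝ≥0∞) : EReal) := by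
  have h : ∀ n, n ≤ M.N →
      M.expTheta P 0 M.Q 0 ≤ ∫⁻ ω, M.stoppedDisutility P v τ n ω ∂P := by
    intro n
    induction n with
    | zero => intro _; rw [lintegral_stoppedDisutility_zero]
    | succ n ih =>
      intro hn
      exact (ih (by omega)).trans (lintegral_stoppedDisutility_le_succ hM hε hadm hn)
  rw [expectedUtility_eq hM hadm]
  exact EReal.neg_le_neg_iff.2 (EReal.coe_ennreal_le_coe_ennreal_iff.2 (h M.N le_rfl))

/-! ### The optimal strategy -/

/-- Trade at the measurable minimiser and deliver at the first permitted date at which delivery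
attains the minimum in the recursion. -/
theorem exists_optimal_strategy (hM : M.IsRegular) (hε : M.IsNoise ℱ P) :
    ∃ v τ, M.Admissible ℱ v τ ∧ (∀ n ω, n < τ ω →
        M.expTheta P n (M.shares M.Q v n ω) (M.spread v n ω) =
          M.contCost P n (M.shares M.Q v n ω) (M.spread v n ω) (v n ω)) ∧
      ∀ ω, M.expTheta P (τ ω) (M.shares M.Q v (τ ω) ω) (M.spread v (τ ω) ω) =
        M.deliveryCost (M.shares M.Q v (τ ω) ω) := by
  classical
  -- The rate is set to zero from `N` on because adaptedness is required at all times, while the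
  -- noise is controlled only up to `N`.
  have hex : ∀ n, ∃ s : ℝ × ℝ → ℝ, Measurable s ∧
      (n < M.N → ∀ p, M.contCost P n p.1 p.2 (s p) = ⨅ v, M.contCost P n p.1 p.2 v) ∧
      (M.N ≤ n → s = 0) := by
    intro n
    by_cases hn : n < M.N
    · obtain ⟨s, hs, hopt⟩ := exists_measurable_optimal_rate hM hε hn
      exact ⟨s, hs, fun _ => hopt, fun h => absurd h (not_le.2 hn)⟩
    · exact ⟨0, measurable_const, fun h => absurd h hn, fun _ => rfl⟩
  choose s hs hopt hs0 using hex
  set v : ℕ → Ω → ℝ := fun n ω => s n (M.feedbackState s n ω) with hv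
  have hstate : ∀ n ω, M.feedbackState s n ω = (M.shares M.Q v n ω, M.spread v n ω) :=
    feedbackState_eq s
  have hvad : Adapted ℱ v := by
    intro n
    by_cases hn : n < M.N
    · exact (hs n).comp (measurable_feedbackState hM hε hs hn.le)
    · simp only [hv, hs0 n (not_lt.1 hn)]
      exact measurable_const
  let D : ℕ → Ω → Prop := fun n ω => n = M.N ∨ (n ∈ M.exercise ∧
    M.expTheta P n (M.shares M.Q v n ω) (M.spread v n ω) = M.deliveryCost (M.shares M.Q v n ω))
  have hD : ∀ ω, ∃ n, D n ω := fun ω => ⟨M.N, Or.inl rfl⟩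
  have hDmeas : ∀ n, MeasurableSet[ℱ n] {ω | D n ω} := by
    intro n
    by_cases hnN : n = M.N
    · have : {ω | D n ω} = Set.univ := Set.eq_univ_of_forall fun ω => Or.inl hnN
      rw [this]
      exact MeasurableSet.univ
    by_cases hn : n ∈ M.exercise
    · have hlt := (hM.exercise_subset n hn).2
      have hset : {ω | D n ω} = {ω | M.expTheta P n (M.shares M.Q v n ω) (M.spread v n ω) =
          M.deliveryCost (M.shares M.Q v n ω)} := by
        ext ω
        exact ⟨fun h => (h.resolve_left hnN).2, fun h => Or.inr ⟨hn, h⟩⟩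
      rw [hset]
      have hq := measurable_shares (M := M) hvad n
      have hZ := measurable_spread hM hε hvad hlt.le
      have hE : MeasurableSet {p : ℝ × ℝ | M.expTheta P n p.1 p.2 = M.deliveryCost p.1} :=
        measurableSet_eq_fun (lowerSemicontinuous_expTheta hM hε hlt.le).measurable
          ((continuous_deliveryCost hM).measurable.comp measurable_fst)
      have hqZ : Measurable[ℱ n] fun ω => (M.shares M.Q v n ω, M.spread v n ω) := hq.prodMk hZ
      exact hqZ hE
    · have : {ω | D n ω} = ∅ := Set.eq_empty_of_forall_notMem fun ω h =>
        h.elim hnN fun h => hn h.1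
      rw [this]
      exact @MeasurableSet.empty _ (ℱ n)
  refine ⟨v, fun ω => Nat.find (hD ω), ⟨hvad, fun n => ?_, fun ω => ?_⟩, fun n ω hn => ?_,
    fun ω => ?_⟩
  · have hset : {ω | ((Nat.find (hD ω) : ℕ) : WithTop ℕ) ≤ (n : ℕ)} =
        ⋃ k ∈ Set.Iic n, {ω | D k ω} := by
      ext ω
      simp [Nat.find_le_iff]
    refine (congrArg (fun A => MeasurableSet[ℱ n] A) hset).mpr ?_
    exact MeasurableSet.biUnion (Set.to_countable _) fun k hk => ℱ.mono hk _ (hDmeas k)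
  · rcases Nat.find_spec (hD ω) with h | h
    · exact Or.inr h
    · exact Or.inl h.1
  · have hnD := Nat.find_min (hD ω) hn
    have hnN : n < M.N := hn.trans_le (Nat.find_min' (hD ω) (Or.inl rfl))
    have h1 := hopt n hnN (M.shares M.Q v n ω, M.spread v n ω)
    rw [← hstate n ω] at h1
    change M.contCost P n (M.feedbackState s n ω).1 (M.feedbackState s n ω).2 (v n ω) = _ at h1
    rw [hstate n ω] at h1
    rw [h1]
    have h2 := expTheta_of_lt (P := P) hM.γ_pos hnN (M.shares M.Q v n ω) (M.spread v n ω)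
    by_cases hne : n ∈ M.exercise
    · rw [if_pos hne] at h2
      rcases min_choice (⨅ w, M.contCost P n (M.shares M.Q v n ω) (M.spread v n ω) w)
        (M.deliveryCost (M.shares M.Q v n ω)) with h | h
      · exact h2.trans h
      -- If the minimum were the delivery cost, the first delivery time would already have come.
      · exact absurd (Or.inr ⟨hne, h2.trans h⟩) hnD
    · rw [if_neg hne] at h2
      exact h2
  · rcases Nat.find_spec (hD ω) with h | h
    · simp only [h, expTheta_N]
    · exact h.2

theorem valueZero_eq (hM : M.IsRegular) (hε : M.IsNoise ℱ P) (S : ℝ) :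
    M.valueZero ℱ P 0 M.Q S = -((M.expTheta P 0 M.Q 0 : ℝ≥0∞) : EReal) := by
  refine le_antisymm (iSup_le fun v => iSup_le fun τ => iSup_le fun hadm =>
    expectedUtility_le hM hε hadm S) ?_
  obtain ⟨v, τ, hadm, hhold, hdeliver⟩ := exists_optimal_strategy hM hε
  have h : ∀ n, n ≤ M.N →
      ∫⁻ ω, M.stoppedDisutility P v τ n ω ∂P = M.expTheta P 0 M.Q 0 := by
    intro n
    induction n with
    | zero => intro _; rw [lintegral_stoppedDisutility_zero]
    | succ n ih =>
      intro hn
      rw [← lintegral_stoppedDisutility_eq_succ hM hε hadm hhold hdeliver hn, ih (by omega)]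
  have heq : M.expectedUtility P 0 M.Q S v τ = -((M.expTheta P 0 M.Q 0 : ℝ≥0∞) : EReal) := by
    rw [expectedUtility_eq hM hadm, h M.N le_rfl]
  rw [← heq]
  exact le_iSup_of_le v (le_iSup_of_le τ (le_iSup_of_le hadm le_rfl))

end DynamicProgramming

/-! ### The indifference price -/

section Price

variable {Ω : Type*} [mΩ : MeasurableSpace Ω] {P : Measure Ω} {M : Model Ω}

/-- At `n = 0` and `q = Q` the coefficient `q - Q / (n + 1)` of `ε_1` is zero, the factor `n / (n +
1)` resets the spread to `0`, and time `0` is not a delivery date. -/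
theorem theta_zero (hM : M.IsRegular) :
    M.theta P 0 M.Q 0 = ⨅ v : ℝ, M.entropic P fun ω =>
        ((-(M.σ * v * M.δt ^ (3 / 2 : ℝ) / √3 * M.ε' 1 ω)
            - M.Q * (M.G (M.Q - v * M.δt) - M.G M.Q)
            + M.L (v / M.V 1) * M.V 1 * M.δt : ℝ) : EReal)
          + M.theta P 1 (M.Q - v * M.δt) 0 := by
  classical
  have h0 : 0 < M.N := by
    have := two_le_N hM
    omega
  have hex : 0 ∉ M.exercise := fun h => by
    have := hM.exercise_subset 0 h
    omega
  rw [theta, dif_pos h0]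
  simp only [hex, if_false]
  refine iInf_congr fun v => congrArg _ (funext fun ω => ?_)
  simp

/-- The continuation value `t` is deterministic and factors out of the expectation. Comparing
exponentials makes this valid also for infinite `t` or an infinite moment. -/
theorem entropic_eq_cumulantGF (hM : M.IsRegular) (hε' : Measurable (M.ε' 1)) (v c : ℝ)
    (t : EReal) :
    (M.entropic P fun ω => ((-(M.σ * v * M.δt ^ (3 / 2 : ℝ) / √3 * M.ε' 1 ω) - M.Q *
        (M.G (M.Q - v * M.δt) - M.G M.Q) + c : ℝ) : EReal) + t) =
      ((1 / M.γ : ℝ) : EReal)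
          * cumulantGF (fun ω => M.σ * √M.δt * M.ε' 1 ω) P (-M.γ * (v * M.δt / √3))
        + ((-(M.Q * (M.G (M.Q - v * M.δt) - M.G M.Q)) + c : ℝ) : EReal) + t := by
  have hγ := hM.γ_pos
  refine (expMul_strictMono hγ).injective ?_
  rw [expMul_entropic hγ, expMul_add hγ, expMul_add hγ, cumulantGF, expMul_log hγ, expMul_coe]
  simp only [expMul_add hγ, expMul_coe]
  rw [lintegral_mul_const _ (by fun_prop)]
  congr 1
  rw [← lintegral_mul_const _ (by fun_prop)]
  refine lintegral_congr fun ω => ?_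
  rw [← ENNReal.ofReal_mul (Real.exp_pos _).le, ← Real.exp_add]
  congr 2
  have hpow : M.δt ^ (3 / 2 : ℝ) = M.δt * √M.δt := by
    rw [Real.sqrt_eq_rpow, show (3 / 2 : ℝ) = 1 + 1 / 2 by norm_num, Real.rpow_add hM.δt_pos,
      Real.rpow_one]
  rw [hpow]
  ring

end Price

end Model

end ASR

end

open ASR ASR.Model in
/-- The indifference price exists, is unique and finite, and is given by both formulas. -/
theorem mainTheorem5 {Ω : Type*} [mΩ : MeasurableSpace Ω] (P : Measure Ω) [IsProbabilityMeasure P]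
    (ℱ : Filtration ℕ mΩ) (M : ASR.Model Ω) (hM : M.IsRegular) (hε : M.IsNoise ℱ P) :
    ∃ p : ℝ, (∀ p' : ℝ, M.IsIndifferencePrice ℱ P p' ↔ p' = p) ∧
      (p : EReal) = (⨅ v : ℝ, M.entropic P fun ω =>
        ((-(M.σ * v * M.δt ^ (3 / 2 : ℝ) / √3 * M.ε' 1 ω)
            - M.Q * (M.G (M.Q - v * M.δt) - M.G M.Q)
            + M.L (v / M.V 1) * M.V 1 * M.δt : ℝ) : EReal)
          + M.theta P 1 (M.Q - v * M.δt) 0) ∧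
      (p : EReal) = ⨅ v : ℝ,
        ((1 / M.γ : ℝ) : EReal)
            * ASR.cumulantGF (fun ω => M.σ * √M.δt * M.ε' 1 ω) P (-M.γ * (v * M.δt / √3))
          + ((-(M.Q * (M.G (M.Q - v * M.δt) - M.G M.Q))
              + M.L (v / M.V 1) * M.V 1 * M.δt : ℝ) : EReal)
          + M.theta P 1 (M.Q - v * M.δt) 0 := by
  have hγ := hM.γ_pos
  have hN := two_le_N hM
  have hlt := expTheta_zero_lt_top hM hε
  have hpos := expTheta_pos hM hε (Nat.zero_le _) M.Q 0
  have hθ := theta_zero (P := P) hM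
  set θ := M.theta P 0 M.Q 0 with hθdef
  have hexp : M.expTheta P 0 M.Q 0 = expMul M.γ θ := rfl
  -- Positivity and finiteness of `exp (γ θ)` make `θ` real; injectivity of the exponential then
  -- gives uniqueness of the price.
  have hbot : θ ≠ ⊥ := by
    intro h
    rw [hexp, h, expMul, EReal.coe_mul_bot_of_pos hγ] at hpos
    exact hpos.ne' EReal.exp_bot
  have htop : θ ≠ ⊤ := by
    intro h
    rw [hexp, h, expMul, EReal.coe_mul_top_of_pos hγ] at hlt
    exact hlt.ne EReal.exp_top
  obtain ⟨p, hp⟩ : ∃ p : ℝ, (p : EReal) = θ := ⟨θ.toReal, EReal.coe_toReal htop hbot⟩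
  have hval : M.valueZero ℱ P 0 M.Q M.S₀ = ((-Real.exp (M.γ * p) : ℝ) : EReal) := by
    rw [valueZero_eq hM hε, hexp, ← hp, expMul_coe, EReal.coe_ennreal_ofReal,
      max_eq_left (Real.exp_pos _).le, EReal.coe_neg]
  refine ⟨p, fun p' => ?_, hp.trans hθ, hp.trans (hθ.trans (iInf_congr fun v => ?_))⟩
  · rw [IsIndifferencePrice, hval, EReal.coe_eq_coe_iff, neg_inj, Real.exp_eq_exp, neg_mul_neg,
      mul_right_inj' hγ.ne', eq_comm]
  · exact entropic_eq_cumulantGF hM (measurable_ε' hε (by omega : 0 < M.N)) v _ _
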